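/- Let $\mathcal{C}$ be a pointed model category with functorial factorizations, and let $[W,F]$ denote the set of morphisms from $W$ to $F$ in the homotopy category $\mathrm{Ho}(\mathcal{C})$. The fibre of a map $p$ is its base change along $* \to Y$, where $Y$ is the target of $p$. A cofibration $i : A \to B$ has an *obstruction theory* if there are an object $W$ and, for every fibration $p : X \to Y$ with fibre $F$ and every commutative square $s : i \to p$ (that is, maps $A \to X$ and $B \to Y$ with equal composites $A \to Y$), a class $\alpha_{p,s} \in [W,F]$ such that 1. the square $s$ has a lift $B \to X$ (making both triangles commute) if and only if $\alpha_{p,s}$ is the class of the zero map; 2. for every commutative square $\varphi : p \to p'$ between fibrations, with induced map of fibres $F \to F'$, the class $\alpha_{p',\varphi s}$ is the composite of $\alpha_{p,s}$ with $F \to F'$. The cofibration $i$ has a *fibrant obstruction theory* if the same holds with all fibrations $p, p'$ required to have fibrant target. The suspension $\Sigma A$ is the cofibre of the inclusion $A \to CA$ into a functorial cone, where $A \to CA \to *$ is a factorization into a cofibration followed by an acyclic fibration. The category $\mathcal{C}$ is *stable* if the left derived functor of $\Sigma$ (obtained by applying $\Sigma$ to a functorial cofibrant replacement) is a self-equivalence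 of $\mathrm{Ho}(\mathcal{C})$. The category $\mathcal{C}$ is *left proper* if cobase changes of weak equivalences along cofibrations are weak equivalences, and *right proper* if base changes of weak equivalences along fibrations are weak equivalences. **Corollary 8.4.** Let $\mathcal{C}$ be a stable model category (pointed, with functorial factorizations). Then: - every cofibration in $\mathcal{C}$ with cofibrant source has a fibrant obstruction theory; - if $\mathcal{C}$ is left proper, then every cofibration in $\mathcal{C}$ has a fibrant obstruction theory; - if $\mathcal{C}$ is left and right proper, then every cofibration in $\mathcal{C}$ has an obstruction theory. -/

import Mathlib

open CategoryTheory Limits HomotopicalAlgebra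

universe v u

namespace ObstructionTheory

/-! ## Properness -/

section Proper

variable (C : Type u) [Category.{v} C] [ModelCategory C]

/-- A model category is left proper if cobase changes of weak equivalences along cofibrations
are weak equivalences. -/
class IsLeftProper : Prop where
  weakEquivalence_of_isPushout {A B A' B' : C} {i : A ⟶ B} {f : A ⟶ A'} {g : B ⟶ B'}
    {j : A' ⟶ B'} (sq : IsPushout i f g j) (hi : Cofibration i) (hf : WeakEquivalence f) :
    WeakEquivalence g

/-- A model category is right proper if base changes of weak equivalences along fibrations
are weak equivalences. -/
class IsRightProper : Prop where
  weakEquivalence_of_isPullback {X Y X' Y' : C} {g : X' ⟶ X} {q : X' ⟶ Y'} {p : X ⟶ Y}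
    {f : Y' ⟶ Y} (sq : IsPullback g q p f) (hp : Fibration p) (hf : WeakEquivalence f) :
    WeakEquivalence g

end Proper

/-! ## The homotopy category and obstruction theories -/

section Obstruction

variable {C : Type u} [Category.{v} C] [ModelCategory C]

variable (C) in
/-- The homotopy category: the localization of `C` at the weak equivalences. Its morphisms are
the weak homotopy classes of maps. -/
abbrev Ho : Type u := (weakEquivalences C).Localization

variable (C) in
/-- The localization functor from a model category to its homotopy category. -/
abbrev toHo : C ⥤ Ho C := (weakEquivalences C).Q

variable [HasZeroMorphisms C]

/-- The fibre of a map `p : X ⟶ Y` in a pointed category (an object of the arrow category):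
the kernel of `p`, which is the base change of `p` along the zero map to `Y`. -/
noncomputable abbrev fibre (p : Arrow C) : C := kernel p.hom

/-- The map of fibres induced by a commutative square `p ⟶ p'`. -/
noncomputable abbrev fibreMap {p p' : Arrow C} (φ : p ⟶ p') : fibre p ⟶ fibre p' :=
  kernel.map p.hom p'.hom φ.left φ.right φ.w.symm

/-- An obstruction theory for the map `i` relative to a class `S` of maps `p : X ⟶ Y`: an object
`W`, together with an obstruction in `[W, fibre p]` for every commutative square `i ⟶ p` with `p`
in `S`, which vanishes if and only if the square has a lift, and which is functorial in `p`. -/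
structure RelativeObstructionTheory (S : MorphismProperty C) {A B : C} (i : A ⟶ B) where
  /-- the object from which the obstructions are maps -/
  W : C
  /-- the obstruction attached to a square -/
  obstruction (p : Arrow C) (hp : S p.hom) (sq : Arrow.mk i ⟶ p) :
    (toHo C).obj W ⟶ (toHo C).obj (fibre p)
  /-- the obstruction is the trivial class if and only if the square has a lift -/
  obstruction_eq_zero_iff (p : Arrow C) (hp : S p.hom) (sq : Arrow.mk i ⟶ p) :
    obstruction p hp sq = (toHo C).map (0 : W ⟶ fibre p) ↔
      ∃ l : B ⟶ p.left, i ≫ l = sq.left ∧ l ≫ p.hom = sq.right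
  /-- the obstruction is functorial -/
  obstruction_comp (p p' : Arrow C) (hp : S p.hom) (hp' : S p'.hom) (sq : Arrow.mk i ⟶ p)
    (φ : p ⟶ p') :
    obstruction p' hp' (sq ≫ φ) = obstruction p hp sq ≫ (toHo C).map (fibreMap φ)

variable (C) in
/-- The class of fibrations with fibrant target. -/
def fibrationsWithFibrantTarget : MorphismProperty C :=
  fun _ Y p ↦ Fibration p ∧ IsFibrant Y

/-- The cofibration `i` has an obstruction theory (with respect to all fibrations). -/
def HasObstructionTheory {A B : C} (i : A ⟶ B) : Prop :=
  Nonempty (RelativeObstructionTheory (fibrations C) i)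

/-- The cofibration `i` has a fibrant obstruction theory: an obstruction theory with respect to
the fibrations with fibrant target. -/
def HasFibrantObstructionTheory {A B : C} (i : A ⟶ B) : Prop :=
  Nonempty (RelativeObstructionTheory (fibrationsWithFibrantTarget C) i)

end Obstruction

/-! ## Cofibres and weak equivalences -/

section Cofibre

variable {C : Type u} [Category.{v} C] [ModelCategory C] [HasZeroMorphisms C]

/-- Taking the cofibre under `B` preserves trivial cofibrations. -/
lemma weakEquivalence_cokernel_map_of_cofibration {B P Z : C} (j : B ⟶ P) (u : P ⟶ Z)
    (k : B ⟶ Z) (h : j ≫ u = 𝟙 B ≫ k) [Cofibration u] [WeakEquivalence u] :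
    WeakEquivalence (cokernel.map j k (𝟙 B) u h) := by
  have sq : IsPushout u (cokernel.π j) (cokernel.π k) (cokernel.map j k (𝟙 B) u h) := by
    refine ⟨⟨by simp⟩, ⟨PushoutCocone.IsColimit.mk _
      (fun s ↦ cokernel.desc k s.inl ?_) ?_ ?_ ?_⟩⟩
    · have := s.condition
      rw [Category.id_comp] at h
      rw [← h, Category.assoc, this, cokernel.condition_assoc, zero_comp]
    · intro s; simp
    · intro s
      ext
      simpa using s.condition
    · intro s m h₁ h₂
      ext
      simpa using h₁
  rw [weakEquivalence_iff]
  exact (MorphismProperty.of_isPushout sq.flip (mem_trivialCofibrations u)).2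

/-- Taking the cofibre under `B` preserves weak equivalences between cofibrations out of `B`. -/
lemma weakEquivalence_cokernel_map_id {B P Q : C} (j : B ⟶ P) (g : P ⟶ Q)
    (k : B ⟶ Q) (h : j ≫ g = 𝟙 B ≫ k) [Cofibration j] [Cofibration k] [WeakEquivalence g] :
    WeakEquivalence (cokernel.map j k (𝟙 B) g h) := by
  rw [Category.id_comp] at h
  let d : pushout j k ⟶ Q := pushout.desc g (𝟙 Q) (by simp [h])
  let F := MorphismProperty.factorizationData (cofibrations C) (trivialFibrations C) d
  let a : P ⟶ F.Z := pushout.inl j k ≫ F.i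
  let s : Q ⟶ F.Z := pushout.inr j k ≫ F.i
  have ha : a ≫ F.p = g := by simp [a, d, pushout.inl_desc]
  have hs : s ≫ F.p = 𝟙 Q := by simp [s, d, pushout.inr_desc]
  have : WeakEquivalence a := weakEquivalence_of_postcomp_of_fac ha
  have : WeakEquivalence s := weakEquivalence_of_postcomp_of_fac hs
  have : Cofibration a := by dsimp only [a]; infer_instance
  have : Cofibration s := by dsimp only [s]; infer_instance
  have h₁ : j ≫ a = 𝟙 B ≫ (j ≫ a) := by simp
  have h₂ : k ≫ s = 𝟙 B ≫ (j ≫ a) := by simp [a, s, pushout.condition_assoc]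
  have h₃ : (j ≫ a) ≫ F.p = 𝟙 B ≫ k := by simp [ha, h]
  have w₁ := weakEquivalence_cokernel_map_of_cofibration j a (j ≫ a) h₁
  have w₂ := weakEquivalence_cokernel_map_of_cofibration k s (j ≫ a) h₂
  have w₃ : WeakEquivalence (cokernel.map (j ≫ a) k (𝟙 B) F.p h₃) := by
    refine weakEquivalence_of_precomp_of_fac
      (f := cokernel.map k (j ≫ a) (𝟙 B) s h₂) (fg := 𝟙 _) ?_
    ext
    simp [reassoc_of% hs]
  have e : cokernel.map j k (𝟙 B) g (by simpa using h) =
      cokernel.map j (j ≫ a) (𝟙 B) a h₁ ≫ cokernel.map (j ≫ a) k (𝟙 B) F.p h₃ := by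
    ext
    simp [reassoc_of% ha]
  rw [e]
  infer_instance

/-- The cofibre is unchanged by cobase change. -/
lemma isIso_cokernel_map_pushout {A B X : C} (a : A ⟶ X) (f : A ⟶ B) :
    IsIso (cokernel.map a (pushout.inr a f) f (pushout.inl a f) pushout.condition) := by
  refine ⟨cokernel.desc _ (pushout.desc (cokernel.π a) 0 (by simp)) (by simp [pushout.inr_desc]), ?_, ?_⟩
  · ext; simp [pushout.inl_desc]
  · ext
    · simp [pushout.inl_desc_assoc]
    · simp [pushout.inr_desc_assoc]

/-- A weak equivalence between cofibrations whose map of sources is a trivial cofibration induces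
a weak equivalence of cofibres. -/
lemma weakEquivalence_cokernel_map {A B X Y : C} (a : A ⟶ X) (b : B ⟶ Y) (f : A ⟶ B) (g : X ⟶ Y)
    (h : a ≫ g = f ≫ b) [Cofibration a] [Cofibration b] [Cofibration f] [WeakEquivalence f]
    [WeakEquivalence g] : WeakEquivalence (cokernel.map a b f g h) := by
  let d : pushout a f ⟶ Y := pushout.desc g b h
  have hd : pushout.inl a f ≫ d = g := by simp [d, pushout.inl_desc]
  have hd' : pushout.inr a f ≫ d = 𝟙 B ≫ b := by simp [d, pushout.inr_desc]
  have : WeakEquivalence d := weakEquivalence_of_precomp_of_fac hd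
  have := weakEquivalence_cokernel_map_id (pushout.inr a f) d b hd'
  have := isIso_cokernel_map_pushout a f
  have e : cokernel.map a b f g h =
      cokernel.map a (pushout.inr a f) f (pushout.inl a f) pushout.condition ≫
        cokernel.map (pushout.inr a f) b (𝟙 B) d hd' := by
    ext
    simp [reassoc_of% hd]
  rw [e]
  infer_instance

end Cofibre

/-! ## Suspension -/

section Suspension

variable {C : Type u} [Category.{v} C] [ModelCategory C]
  [(cofibrations C).HasFunctorialFactorization (trivialFibrations C)]

/-- The functorial factorization of maps as a cofibration followed by a trivial fibration. -/
noncomputable abbrev factData :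
    (cofibrations C).FunctorialFactorizationData (trivialFibrations C) :=
  MorphismProperty.functorialFactorizationData _ _

/-- The functorial cofibrant replacement: factor `⊥_ C ⟶ X` as a cofibration followed by
a trivial fibration. -/
noncomputable def cofibrantReplacement : C ⥤ C where
  obj X := (factData.factorizationData (initial.to X)).Z
  map {X Y} f := factData.mapZ (Arrow.homMk (𝟙 _) f (by simp) :
    Arrow.mk (initial.to X) ⟶ Arrow.mk (initial.to Y))
  map_id X := by
    rw [← MorphismProperty.FunctorialFactorizationData.mapZ_id]
    rfl
  map_comp f g := by
    rw [← MorphismProperty.FunctorialFactorizationData.mapZ_comp]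
    congr 1
    ext <;> simp

/-- The functorial cone on `A`: factor `A ⟶ ⊤_ C` as a cofibration followed by
a trivial fibration. -/
noncomputable def cone : C ⥤ C where
  obj A := (factData.factorizationData (terminal.from A)).Z
  map {A B} f := factData.mapZ (Arrow.homMk f (𝟙 _) (by simp) :
    Arrow.mk (terminal.from A) ⟶ Arrow.mk (terminal.from B))
  map_id X := by
    rw [← MorphismProperty.FunctorialFactorizationData.mapZ_id]
    rfl
  map_comp f g := by
    rw [← MorphismProperty.FunctorialFactorizationData.mapZ_comp]
    congr 1
    ext <;> simp

/-- The inclusion of `A` in its cone. -/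
noncomputable def toCone (A : C) : A ⟶ cone.obj A :=
  (factData.factorizationData (terminal.from A)).i

lemma toCone_naturality {A B : C} (f : A ⟶ B) :
    toCone A ≫ cone.map f = f ≫ toCone B :=
  factData.i_mapZ (Arrow.homMk f (𝟙 _) (by simp) :
    Arrow.mk (terminal.from A) ⟶ Arrow.mk (terminal.from B))

instance (A : C) : Cofibration (toCone A) :=
  inferInstanceAs (Cofibration (factData.factorizationData (terminal.from A)).i)

instance (A : C) : WeakEquivalence (terminal.from (cone.obj A)) := by
  rw [Subsingleton.elim (terminal.from (cone.obj A))
    (factData.factorizationData (terminal.from A)).p]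
  exact inferInstanceAs (WeakEquivalence (factData.factorizationData (terminal.from A)).p)

instance {A B : C} (f : A ⟶ B) : WeakEquivalence (cone.map f) :=
  weakEquivalence_of_postcomp_of_fac (g := terminal.from (cone.obj B))
    (fg := terminal.from (cone.obj A)) (Subsingleton.elim _ _)

instance (X : C) : IsCofibrant (cofibrantReplacement.obj X) := by
  have h : Cofibration (factData.factorizationData (initial.to X)).i := inferInstance
  rwa [Subsingleton.elim (factData.factorizationData (initial.to X)).i (initial.to _)] at h

/-- The trivial fibration from the cofibrant replacement. -/
noncomputable def fromCofibrantReplacement (X : C) : cofibrantReplacement.obj X ⟶ X :=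
  (factData.factorizationData (initial.to X)).p

instance (X : C) : WeakEquivalence (fromCofibrantReplacement X) :=
  inferInstanceAs (WeakEquivalence (factData.factorizationData (initial.to X)).p)

lemma fromCofibrantReplacement_naturality {X Y : C} (f : X ⟶ Y) :
    cofibrantReplacement.map f ≫ fromCofibrantReplacement Y = fromCofibrantReplacement X ≫ f :=
  factData.mapZ_p (Arrow.homMk (𝟙 _) f (by simp) :
    Arrow.mk (initial.to X) ⟶ Arrow.mk (initial.to Y))

instance {X Y : C} (f : X ⟶ Y) [WeakEquivalence f] :
    WeakEquivalence (cofibrantReplacement.map f) :=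
  weakEquivalence_of_postcomp_of_fac (fromCofibrantReplacement_naturality f)

variable [HasZeroMorphisms C]

/-- The suspension functor: the cofibre of the inclusion of `A` in its cone. -/
noncomputable def suspension : C ⥤ C where
  obj A := cokernel (toCone A)
  map f := cokernel.map _ _ f (cone.map f) (toCone_naturality f)

/-- Suspension preserves weak equivalences between cofibrant objects. -/
lemma weakEquivalence_suspension_map {A B : C} (f : A ⟶ B) [IsCofibrant A] [IsCofibrant B]
    [WeakEquivalence f] : WeakEquivalence (suspension.map f) := by
  have key {A B : C} (f : A ⟶ B) [Cofibration f] [WeakEquivalence f] :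
      WeakEquivalence (suspension.map f) :=
    weakEquivalence_cokernel_map _ _ f (cone.map f) (toCone_naturality f)
  let F : CofibrantBrownFactorization f := Classical.arbitrary _
  have := key F.i
  have := key F.s
  have : WeakEquivalence (suspension.map F.p) := by
    refine weakEquivalence_of_precomp_of_fac (f := suspension.map F.s) (fg := 𝟙 _) ?_
    rw [← CategoryTheory.Functor.map_comp, F.s_p, CategoryTheory.Functor.map_id]
  rw [← F.fac, CategoryTheory.Functor.map_comp]
  infer_instance

variable (C) in
/-- The suspension of the cofibrant replacement inverts weak equivalences, up to homotopy. -/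
lemma isInvertedBy_suspension : (weakEquivalences C).IsInvertedBy
    (cofibrantReplacement ⋙ suspension ⋙ toHo C) := by
  intro X Y f hf
  have : WeakEquivalence f := ⟨hf⟩
  have := weakEquivalence_suspension_map (cofibrantReplacement.map f)
  exact Localization.inverts (toHo C) (weakEquivalences C) _ (mem_weakEquivalences _)

variable (C) in
/-- The left derived suspension functor on the homotopy category: it is obtained by applying the
suspension functor to a cofibrant replacement. -/
noncomputable def leftDerivedSuspension : Ho C ⥤ Ho C :=
  Localization.lift (cofibrantReplacement ⋙ suspension ⋙ toHo C)
    (isInvertedBy_suspension C) (toHo C)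

variable (C) in
/-- A pointed model category is stable if the left derived suspension is a self-equivalence of
its homotopy category. -/
class IsStable : Prop where
  isEquivalence : (leftDerivedSuspension C).IsEquivalence

end Suspension

end ObstructionTheory

/-! The obstruction of a square `i ⟶ p` is the map it induces in `Ho C` from the homotopy fibre of
`i` to that of `p`. Homotopy fibres are fibres of functorial replacements by fibrations with fibrant
target, so functoriality in `p` is automatic; `IsReplaceable` records that the replacement of `p`
has the same fibre and the same solvable lifting problems as `p`.

If the square has a lift, it factors through the identity of `p.left`, whose homotopy fibre is
contractible, so the obstruction is trivial.

Conversely, stability makes fibre sequences into cofibre sequences (`exists_resolution_of_kernel`):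
the target `Y` of the replacement `X ⟶ Y` of `i` is equivalent to `X` with a cone attached along its
fibre. A null-homotopic map of fibres extends over the cone, hence maps the whole mapping cone to
the source of the replacement of `p`; as `i` is a cofibration, this map can be restricted to `B`
(`exists_lift_of_toHo_map_kernel_map_eq_zero`).

The comparison of fibre and cofibre sequences rests on the equivalence `Σ Ω V ⟶ V`
(`weakEquivalence_cokernel_desc_of_contractible`) and on two-out-of-six, hence on the saturation of
weak equivalences.

A cofibration with arbitrary source is reduced to one with cofibrant source by left properness.
Right properness makes all fibrations, not only those with fibrant target, replaceable. -/

namespace ObstructionTheory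

/-! ### Saturation of weak equivalences, two-out-of-six, and extension of null-homotopic maps. -/

section Saturation

variable {C : Type u} [Category.{v} C] [ModelCategory C]

instance isIso_toHo_map {X Y : C} (f : X ⟶ Y) [WeakEquivalence f] : IsIso ((toHo C).map f) :=
  Localization.inverts (toHo C) (weakEquivalences C) f (mem_weakEquivalences f)

lemma weakEquivalence_of_toHo_map_eq {X Y : C} [IsCofibrant X] [IsFibrant Y] {f g : X ⟶ Y}
    (h : (toHo C).map f = (toHo C).map g) [WeakEquivalence g] : WeakEquivalence f := by
  obtain ⟨P, ⟨h⟩⟩ := (LeftHomotopyRel.iff_map_eq (toHo C) _ _).2 h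
  rwa [h.weakEquivalence_iff]

/-- A homotopy inverse of `p` can be deformed by the covering homotopy property into a strict
section `s`. Then `p` is a retract of `p ≫ s`, which is homotopic to the identity. -/
lemma weakEquivalence_of_isIso_of_fibration {X Y : C} (p : X ⟶ Y) [IsCofibrant X] [IsFibrant X]
    [IsCofibrant Y] [IsFibrant Y] [Fibration p] [IsIso ((toHo C).map p)] :
    WeakEquivalence p := by
  obtain ⟨g, hg⟩ := map_surjective_of_isLocalization (toHo C) Y X (inv ((toHo C).map p))
  have h₁ : LeftHomotopyRel (g ≫ p) (𝟙 Y) := by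
    rw [LeftHomotopyRel.iff_map_eq (toHo C)]
    simp [hg]
  obtain ⟨P, _, ⟨h⟩⟩ := h₁.exists_good_cylinder
  obtain ⟨s, h', hs⟩ := h.covering_homotopy p g
  have hsp : s ≫ p = 𝟙 Y := by
    rw [← h'.h₁, Category.assoc, hs, h.h₁]
  have hs' : (toHo C).map s = (toHo C).map g :=
    ((LeftHomotopyRel.iff_map_eq (toHo C) _ _).1 h'.leftHomotopyRel).symm
  have h₂ : (toHo C).map (p ≫ s) = (toHo C).map (𝟙 X) := by simp [hs', hg]
  have h₃ : WeakEquivalence (p ≫ s) := weakEquivalence_of_toHo_map_eq h₂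
  let r : RetractArrow p (p ≫ s) :=
    { i := Arrow.homMk (𝟙 X) s
      r := Arrow.homMk (𝟙 X) p (by simp [hsp])
      retract := by ext <;> simp [hsp] }
  rw [weakEquivalence_iff] at h₃ ⊢
  exact MorphismProperty.of_retract r h₃

/-- The class of weak equivalences of a model category is saturated. -/
lemma weakEquivalence_of_isIso_toHo_map {X Y : C} (f : X ⟶ Y) [IsIso ((toHo C).map f)] :
    WeakEquivalence f := by
  -- Up to weak equivalences, `f` is replaced by `G.i`, then by `G.i ≫ H.i`, and finally by `K.p`, a
  -- fibration between objects that are both fibrant and cofibrant.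
  let F := MorphismProperty.factorizationData (cofibrations C) (trivialFibrations C) (initial.to X)
  let G := MorphismProperty.factorizationData (cofibrations C) (trivialFibrations C) (F.p ≫ f)
  let H := MorphismProperty.factorizationData (trivialCofibrations C) (fibrations C)
    (terminal.from G.Z)
  let K := MorphismProperty.factorizationData (trivialCofibrations C) (fibrations C) (G.i ≫ H.i)
  have : IsCofibrant F.Z := by
    rw [isCofibrant_iff, Subsingleton.elim (initial.to F.Z) F.i]
    infer_instance
  have : IsFibrant H.Z := by
    rw [isFibrant_iff, Subsingleton.elim (terminal.from H.Z) H.p]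
    infer_instance
  have : IsCofibrant G.Z := isCofibrant_of_cofibration G.i
  have : IsCofibrant H.Z := isCofibrant_of_cofibration H.i
  have : IsCofibrant K.Z := isCofibrant_of_cofibration K.i
  have : IsFibrant K.Z := isFibrant_of_fibration K.p
  have hG : IsIso ((toHo C).map G.i) := by
    have : IsIso ((toHo C).map G.i ≫ (toHo C).map G.p) := by
      rw [← Functor.map_comp, G.fac, Functor.map_comp]
      infer_instance
    exact IsIso.of_isIso_comp_right _ ((toHo C).map G.p)
  have hK : IsIso ((toHo C).map K.p) := by
    have : IsIso ((toHo C).map K.i ≫ (toHo C).map K.p) := by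
      rw [← Functor.map_comp, K.fac, Functor.map_comp]
      infer_instance
    exact IsIso.of_isIso_comp_left ((toHo C).map K.i) _
  have := weakEquivalence_of_isIso_of_fibration K.p
  have : WeakEquivalence (G.i ≫ H.i) := by
    rw [← K.fac]
    infer_instance
  have := weakEquivalence_of_postcomp G.i H.i
  have : WeakEquivalence (F.p ≫ f) := by
    rw [← G.fac]
    infer_instance
  exact weakEquivalence_of_precomp F.p f

/-- The two-out-of-six property of weak equivalences. -/
lemma weakEquivalence_of_two_out_of_six {X Y Z T : C} (f : X ⟶ Y) (g : Y ⟶ Z) (h : Z ⟶ T)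
    [WeakEquivalence (f ≫ g)] [WeakEquivalence (g ≫ h)] : WeakEquivalence h := by
  let F := toHo C
  have h₁ : IsIso (F.map f ≫ F.map g) := by rw [← Functor.map_comp]; infer_instance
  have h₂ : IsIso (F.map g ≫ F.map h) := by rw [← Functor.map_comp]; infer_instance
  have e₁ : (inv (F.map f ≫ F.map g) ≫ F.map f) ≫ F.map g = 𝟙 _ := by
    rw [Category.assoc, IsIso.inv_hom_id]
  have e₂ : F.map g ≫ F.map h ≫ inv (F.map g ≫ F.map h) = 𝟙 _ := by
    rw [← Category.assoc, IsIso.hom_inv_id]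
  have : IsSplitEpi (F.map g) := ⟨⟨_, e₁⟩⟩
  have : IsSplitMono (F.map g) := ⟨⟨_, e₂⟩⟩
  have : IsIso (F.map g) := isIso_of_mono_of_isSplitEpi _
  have : IsIso (F.map h) := IsIso.of_isIso_comp_left (F.map g) _
  exact weakEquivalence_of_isIso_toHo_map h

/-- A map which is trivial in the homotopy category extends along every cofibration. -/
lemma exists_extension_of_toHo_map_eq_zero [HasZeroMorphisms C] {A B F : C} [IsCofibrant A]
    [IsFibrant F] (f : A ⟶ F) (hf : (toHo C).map f = (toHo C).map 0) (j : A ⟶ B)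
    [Cofibration j] : ∃ d : B ⟶ F, j ≫ d = f := by
  have h : RightHomotopyRel 0 f := by rw [RightHomotopyRel.iff_map_eq (toHo C), hf]
  obtain ⟨P, _, ⟨h⟩⟩ := h.exists_good_pathObject
  obtain ⟨d, h', hd⟩ := h.homotopy_extension j 0
  exact ⟨d, by rw [← h'.h₁, reassoc_of% hd, h.h₁]⟩

end Saturation

/-! ### Contractible objects, fibres and cofibres. -/

section Pointed

variable {C : Type u} [Category.{v} C] [ModelCategory C]

lemma weakEquivalence_of_contractible {D E : C} [WeakEquivalence (terminal.from D)]
    [WeakEquivalence (terminal.from E)] (f : D ⟶ E) : WeakEquivalence f :=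
  weakEquivalence_of_postcomp_of_fac (g := terminal.from E) (fg := terminal.from D)
    (Subsingleton.elim _ _)

/-- Maps from a cofibrant object lift through trivial fibrations. -/
lemma exists_lift_of_isCofibrant {T X Y : C} [IsCofibrant T] (p : X ⟶ Y) [Fibration p]
    [WeakEquivalence p] (f : T ⟶ Y) : ∃ d : T ⟶ X, d ≫ p = f := by
  have sq : CommSq (initial.to X) (initial.to T) p f := ⟨Subsingleton.elim _ _⟩
  exact ⟨sq.lift, sq.fac_right⟩

lemma weakEquivalence_initial_to [HasZeroObject C] (D : C) [WeakEquivalence (terminal.from D)] :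
    WeakEquivalence (initial.to D) := by
  have : IsIso (terminal.from (⊥_ C)) :=
    ((isZero_zero C).of_iso HasZeroObject.zeroIsoInitial.symm).isIso
      ((isZero_zero C).of_iso HasZeroObject.zeroIsoTerminal.symm) _
  exact weakEquivalence_of_postcomp_of_fac (g := terminal.from D) (fg := terminal.from (⊥_ C))
    (Subsingleton.elim _ _)

/-- Maps from a contractible cofibrant object lift through fibrations. -/
lemma exists_lift_of_contractible [HasZeroObject C] {K D V : C} [IsCofibrant K] [WeakEquivalence (terminal.from K)]
    (p : D ⟶ V) [Fibration p] (f : K ⟶ V) : ∃ d : K ⟶ D, d ≫ p = f := by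
  have := weakEquivalence_initial_to K
  have sq : CommSq (initial.to D) (initial.to K) p f := ⟨Subsingleton.elim _ _⟩
  exact ⟨sq.lift, sq.fac_right⟩

variable [HasZeroMorphisms C]

/-- The cokernels of two maps out of the same object are related by cobase change. -/
lemma isPushout_cokernel_map_id {B P Z : C} (j : B ⟶ P) (u : P ⟶ Z) (k : B ⟶ Z)
    (h : j ≫ u = 𝟙 B ≫ k) :
    IsPushout u (cokernel.π j) (cokernel.π k) (cokernel.map j k (𝟙 B) u h) := by
  refine ⟨⟨by simp⟩, ⟨PushoutCocone.IsColimit.mk _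
    (fun s ↦ cokernel.desc k s.inl ?_) ?_ ?_ ?_⟩⟩
  · have := s.condition
    rw [Category.id_comp] at h
    rw [← h, Category.assoc, this, cokernel.condition_assoc, zero_comp]
  · intro s; simp
  · intro s
    ext
    simpa using s.condition
  · intro s m h₁ h₂
    ext
    simpa using h₁

lemma cofibration_cokernel_map_id {B P Z : C} (j : B ⟶ P) (u : P ⟶ Z) (k : B ⟶ Z)
    (h : j ≫ u = 𝟙 B ≫ k) [Cofibration u] : Cofibration (cokernel.map j k (𝟙 B) u h) := by
  rw [cofibration_iff]
  exact MorphismProperty.of_isPushout (isPushout_cokernel_map_id j u k h).flip (mem_cofibrations u)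

/-- The kernels of two maps to the same object are related by base change. -/
lemma isPullback_kernel_map_id {B P Z : C} (p : P ⟶ B) (u : P ⟶ Z) (q : Z ⟶ B)
    (h : p ≫ 𝟙 B = u ≫ q) :
    IsPullback (kernel.map p q u (𝟙 B) h) (kernel.ι p) (kernel.ι q) u := by
  rw [Category.comp_id] at h
  refine ⟨⟨by simp⟩, ⟨PullbackCone.IsLimit.mk _
    (fun s ↦ kernel.lift p s.snd ?_) ?_ ?_ ?_⟩⟩
  · rw [h, ← Category.assoc, ← s.condition, Category.assoc, kernel.condition, comp_zero]
  · intro s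
    ext
    simpa using s.condition.symm
  · intro s; simp
  · intro s m h₁ h₂
    ext
    simpa using h₂

lemma fibration_kernel_map_id {B P Z : C} (p : P ⟶ B) (u : P ⟶ Z) (q : Z ⟶ B)
    (h : p ≫ 𝟙 B = u ≫ q) [Fibration u] : Fibration (kernel.map p q u (𝟙 B) h) := by
  rw [fibration_iff]
  exact MorphismProperty.of_isPullback (isPullback_kernel_map_id p u q h).flip (mem_fibrations u)

lemma isPullback_kernel {X Y : C} (p : X ⟶ Y) :
    IsPullback (kernel.ι p) (terminal.from (kernel p)) p (0 : ⊤_ C ⟶ Y) := by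
  refine ⟨⟨by simp⟩, ⟨PullbackCone.IsLimit.mk _
    (fun s ↦ kernel.lift p s.fst (by rw [s.condition, comp_zero])) ?_ ?_ ?_⟩⟩
  · intro s; simp
  · intro s; exact Subsingleton.elim _ _
  · intro s m h₁ h₂
    ext
    simpa using h₁

lemma isPushout_cokernel {X Y : C} (i : X ⟶ Y) :
    IsPushout i (0 : X ⟶ ⊥_ C) (cokernel.π i) (initial.to (cokernel i)) := by
  refine ⟨⟨by simp⟩, ⟨PushoutCocone.IsColimit.mk _
    (fun s ↦ cokernel.desc i s.inl (by rw [s.condition, zero_comp])) ?_ ?_ ?_⟩⟩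
  · intro s; simp
  · intro s; exact Subsingleton.elim _ _
  · intro s m h₁ h₂
    ext
    simpa using h₁

instance isFibrant_kernel {X Y : C} (p : X ⟶ Y) [Fibration p] : IsFibrant (kernel p) := by
  rw [isFibrant_iff, fibration_iff]
  exact MorphismProperty.of_isPullback (isPullback_kernel p) (mem_fibrations p)

instance isCofibrant_cokernel {X Y : C} (i : X ⟶ Y) [Cofibration i] :
    IsCofibrant (cokernel i) := by
  rw [isCofibrant_iff, cofibration_iff]
  exact MorphismProperty.of_isPushout (isPushout_cokernel i).flip (mem_cofibrations i)

lemma weakEquivalence_terminal_from_kernel {X Y : C} (p : X ⟶ Y) [Fibration p]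
    [WeakEquivalence p] : WeakEquivalence (terminal.from (kernel p)) := by
  rw [weakEquivalence_iff]
  exact (MorphismProperty.of_isPullback (isPullback_kernel p) (mem_trivialFibrations p)).2

/-- Maps which factor through a contractible object are trivial in the homotopy category. -/
lemma toHo_map_eq_zero_of_contractible {A K F : C} [WeakEquivalence (terminal.from K)]
    (f : A ⟶ K) (g : K ⟶ F) : (toHo C).map (f ≫ g) = (toHo C).map 0 := by
  have h : (toHo C).map (𝟙 K) = (toHo C).map 0 := by
    rw [← cancel_mono ((toHo C).map (terminal.from K)), ← Functor.map_comp, ← Functor.map_comp]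
    exact congrArg _ (Subsingleton.elim _ _)
  rw [← Category.id_comp g, Functor.map_comp, Functor.map_comp, h, ← Functor.map_comp,
    ← Functor.map_comp]
  simp

end Pointed

/-! ### Homotopy uniqueness of maps of cofibres and of maps to fibres. -/

section Cone

variable {C : Type u} [Category.{v} C] [ModelCategory C] [HasZeroMorphisms C]

/-- Two maps of cofibres induced by extensions of the same map to a contractible fibrant object
agree in the homotopy category. -/
lemma toHo_map_cokernel_map_eq {T K G L : C} (j : T ⟶ K) [Cofibration j] (t : T ⟶ G) (l : G ⟶ L)
    [IsFibrant L] [WeakEquivalence (terminal.from L)] (a b : K ⟶ L) (ha : j ≫ a = t ≫ l)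
    (hb : j ≫ b = t ≫ l) :
    (toHo C).map (cokernel.map j l t a ha) = (toHo C).map (cokernel.map j l t b hb) := by
  -- `F.Z` is a cylinder on `K` relative to `T`. Its two ends induce sections `s₀`, `s₁` of the same
  -- weak equivalence `r` of cofibres, so they agree in `Ho C`; contractibility of `L` extends `a`
  -- and `b` over the cylinder.
  let F := MorphismProperty.factorizationData (cofibrations C) (trivialFibrations C)
    (pushout.desc (f := j) (g := j) (𝟙 K) (𝟙 K) rfl)
  let i₀ : K ⟶ F.Z := pushout.inl j j ≫ F.i
  let i₁ : K ⟶ F.Z := pushout.inr j j ≫ F.i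
  have h₀ : i₀ ≫ F.p = 𝟙 K := by simp [i₀, pushout.inl_desc]
  have h₁ : i₁ ≫ F.p = 𝟙 K := by simp [i₁, pushout.inr_desc]
  have h₀₁ : j ≫ i₁ = j ≫ i₀ := by simp [i₀, i₁, pushout.condition_assoc]
  have : WeakEquivalence i₀ := weakEquivalence_of_postcomp_of_fac h₀
  have : Cofibration i₀ := by dsimp only [i₀]; infer_instance
  have sq : CommSq (pushout.desc (f := j) (g := j) a b (by rw [ha, hb])) F.i
    (terminal.from L) (terminal.from F.Z) := ⟨Subsingleton.elim _ _⟩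
  have w₀ : i₀ ≫ sq.lift = a := by simp [i₀, pushout.inl_desc]
  have w₁ : i₁ ≫ sq.lift = b := by simp [i₁, pushout.inr_desc]
  let r : cokernel (j ≫ i₀) ⟶ cokernel j :=
    cokernel.map (j ≫ i₀) j (𝟙 T) F.p (by simp [h₀])
  let s₀ : cokernel j ⟶ cokernel (j ≫ i₀) := cokernel.map j (j ≫ i₀) (𝟙 T) i₀ (by simp)
  let s₁ : cokernel j ⟶ cokernel (j ≫ i₀) := cokernel.map j (j ≫ i₀) (𝟙 T) i₁ (by simp [h₀₁])
  have : WeakEquivalence s₀ := weakEquivalence_cokernel_map_id _ _ _ _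
  have hr₀ : s₀ ≫ r = 𝟙 _ := by ext; simp [s₀, r, reassoc_of% h₀]
  have hr₁ : s₁ ≫ r = 𝟙 _ := by ext; simp [s₁, r, reassoc_of% h₁]
  have : WeakEquivalence r := weakEquivalence_of_precomp_of_fac hr₀
  let d : cokernel (j ≫ i₀) ⟶ cokernel l :=
    cokernel.map (j ≫ i₀) l t sq.lift (by rw [Category.assoc, w₀, ha])
  have hs : (toHo C).map s₀ = (toHo C).map s₁ := by
    rw [← cancel_mono ((toHo C).map r), ← Functor.map_comp, ← Functor.map_comp, hr₀, hr₁]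
  have e₀ : cokernel.map j l t a ha = s₀ ≫ d := by ext; simp [s₀, d, reassoc_of% w₀]
  have e₁ : cokernel.map j l t b hb = s₁ ≫ d := by ext; simp [s₁, d, reassoc_of% w₁]
  rw [e₀, e₁, Functor.map_comp, Functor.map_comp, hs]

/-- Let `p : D ⟶ V` be a fibration between fibrant objects with `D` contractible. If two maps from
the cofibre of `c : T ⟶ K`, with `K` contractible, to `V` agree in the homotopy category, then so
do the maps from `T` to the fibre of `p` obtained from liftings of these maps to `D`. -/
lemma toHo_map_eq_of_lifts_of_contractible [HasZeroObject C] {T K D V : C} [IsCofibrant T]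
    (c : T ⟶ K) [Cofibration c] [WeakEquivalence (terminal.from K)] (p : D ⟶ V) [Fibration p]
    [IsFibrant V] {g₀ g₁ : cokernel c ⟶ V}
    (hg : (toHo C).map g₀ = (toHo C).map g₁)
    (d₀ d₁ : K ⟶ D) (hd₀ : d₀ ≫ p = cokernel.π c ≫ g₀) (hd₁ : d₁ ≫ p = cokernel.π c ≫ g₁)
    (f₀ f₁ : T ⟶ kernel p) (hf₀ : f₀ ≫ kernel.ι p = c ≫ d₀) (hf₁ : f₁ ≫ kernel.ι p = c ≫ d₁) :
    (toHo C).map f₀ = (toHo C).map f₁ := by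
  have : IsCofibrant K := isCofibrant_of_cofibration c
  obtain ⟨Q, _, ⟨H⟩⟩ := ((RightHomotopyRel.iff_map_eq (toHo C) _ _).2 hg).exists_good_pathObject
  obtain ⟨P, _⟩ := Cylinder.exists_very_good T
  have hP : P.i ≫ P.π ≫ c = coprod.map c c ≫ coprod.desc (𝟙 K) (𝟙 K) := by
    ext <;> simp [coprod.inl_desc, coprod.inr_desc]
  -- `F.Z` is a cylinder on `K` containing the chosen cylinder on `T`.
  let F := MorphismProperty.factorizationData (cofibrations C) (trivialFibrations C)
    (pushout.desc (P.π ≫ c) (coprod.desc (𝟙 K) (𝟙 K)) hP)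
  let m : P.I ⟶ F.Z := pushout.inl _ _ ≫ F.i
  let k : K ⨿ K ⟶ F.Z := pushout.inr _ _ ≫ F.i
  have hmk : P.i ≫ m = coprod.map c c ≫ k := by simp [m, k, pushout.condition_assoc]
  have hk : k ≫ F.p = coprod.desc (𝟙 K) (𝟙 K) := by simp [k, pushout.inr_desc]
  have : Cofibration k := by dsimp only [k]; infer_instance
  have : WeakEquivalence (coprod.inl : K ⟶ K ⨿ K) := by
    have := weakEquivalence_initial_to K
    rw [weakEquivalence_iff]
    exact (MorphismProperty.of_isPushout ((IsPushout.of_isColimit_binaryCofan_of_isInitial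
      (colimit.isColimit (pair K K)) initialIsInitial).flip)
      (mem_trivialCofibrations (initial.to K))).2
  have hk' : (coprod.inl ≫ k) ≫ F.p = 𝟙 K := by simp [hk, coprod.inl_desc]
  have : WeakEquivalence (coprod.inl ≫ k) := weakEquivalence_of_postcomp_of_fac hk'
  have : WeakEquivalence k := weakEquivalence_of_precomp coprod.inl k
  have hQ : P.i ≫ (0 : P.I ⟶ Q.P) = coprod.map c c ≫
      coprod.desc (cokernel.π c ≫ g₀ ≫ Q.ι) (cokernel.π c ≫ H.h) := by
    ext <;> simp [coprod.inl_desc, coprod.inr_desc]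
  -- The right homotopy `H` is turned into a left homotopy on `K` that is zero on the cylinder of
  -- `T`: the lift exists because `Q.p₀` is a trivial fibration, and its composite with `Q.p₁` is
  -- this left homotopy.
  have sq : CommSq (pushout.desc 0 _ hQ) F.i Q.p₀ (F.p ≫ cokernel.π c ≫ g₀) := ⟨by
    ext
    · simp [pushout.inl_desc_assoc]
    · simp [pushout.inr_desc_assoc]
    · simp [pushout.inr_desc_assoc]⟩
  have hm : m ≫ sq.lift ≫ Q.p₁ = 0 := by simp [m, pushout.inl_desc_assoc]
  have hk₁ : k ≫ sq.lift ≫ Q.p₁ = coprod.desc d₀ d₁ ≫ p := by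
    ext <;> simp [k, hd₀, hd₁, pushout.inr_desc_assoc]
  -- Since `K` is contractible, the inclusion `k` of both ends is a trivial cofibration, so the
  -- homotopy lifts to `D` with both ends prescribed. On the cylinder of `T` the lift lies in the
  -- fibre.
  have sq' : CommSq (coprod.desc d₀ d₁) k p (sq.lift ≫ Q.p₁) := ⟨hk₁.symm⟩
  have hm' : (m ≫ sq'.lift) ≫ p = 0 := by rw [Category.assoc, sq'.fac_right, hm]
  have hmk' : P.i ≫ m ≫ sq'.lift = coprod.map c c ≫ coprod.desc d₀ d₁ := by
    rw [reassoc_of% hmk, sq'.fac_left]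
  have h : P.LeftHomotopy f₀ f₁ :=
    { h := kernel.lift p _ hm'
      h₀ := by
        ext
        simpa [hf₀, coprod.inl_desc, coprod.inl_desc_assoc] using coprod.inl ≫= hmk'
      h₁ := by
        ext
        simpa [hf₁, coprod.inr_desc, coprod.inr_desc_assoc] using coprod.inr ≫= hmk' }
  exact (LeftHomotopyRel.factorsThroughLocalization C h.leftHomotopyRel).map_eq (toHo C)

end Cone

/-! ### The derived suspension and the equivalence `Σ Ω V ⟶ V`. -/

section Counit

variable {C : Type u} [Category.{v} C] [ModelCategory C] [HasZeroMorphisms C]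
  [(cofibrations C).HasFunctorialFactorization (trivialFibrations C)]

/-- The map of cofibres of the inclusions in the cones which is induced by a map `f`. -/
noncomputable abbrev suspensionMap {T G : C} (f : T ⟶ G) :
    cokernel (toCone T) ⟶ cokernel (toCone G) :=
  cokernel.map _ _ f (cone.map f) (toCone_naturality f)

/-- The derived suspension is the suspension of the cofibrant replacement. -/
noncomputable def leftDerivedSuspensionObjIso' (T : C) :
    (leftDerivedSuspension C).obj ((toHo C).obj T) ≅
      (toHo C).obj (cokernel (toCone (cofibrantReplacement.obj T))) :=
  (Localization.fac (cofibrantReplacement ⋙ suspension ⋙ toHo C)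
    (isInvertedBy_suspension C) (toHo C)).app T

lemma leftDerivedSuspensionObjIso'_naturality {T G : C} (f : T ⟶ G) :
    (leftDerivedSuspension C).map ((toHo C).map f) ≫ (leftDerivedSuspensionObjIso' G).hom =
      (leftDerivedSuspensionObjIso' T).hom ≫
        (toHo C).map (suspensionMap (cofibrantReplacement.map f)) :=
  (Localization.fac (cofibrantReplacement ⋙ suspension ⋙ toHo C)
    (isInvertedBy_suspension C) (toHo C)).hom.naturality f

instance weakEquivalence_suspensionMap (T : C) [IsCofibrant T] :
    WeakEquivalence (suspensionMap (fromCofibrantReplacement T)) :=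
  weakEquivalence_suspension_map (fromCofibrantReplacement T)

/-- The derived suspension of a cofibrant object is its suspension. -/
noncomputable def leftDerivedSuspensionObjIso (T : C) [IsCofibrant T] :
    (leftDerivedSuspension C).obj ((toHo C).obj T) ≅ (toHo C).obj (cokernel (toCone T)) :=
  leftDerivedSuspensionObjIso' T ≪≫
    asIso ((toHo C).map (suspensionMap (fromCofibrantReplacement T)))

lemma suspensionMap_comp {T G H : C} (f : T ⟶ G) (g : G ⟶ H) :
    suspensionMap (f ≫ g) = suspensionMap f ≫ suspensionMap g :=
  suspension.map_comp f g

lemma leftDerivedSuspensionObjIso_naturality {T G : C} [IsCofibrant T] [IsCofibrant G]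
    (f : T ⟶ G) :
    (leftDerivedSuspension C).map ((toHo C).map f) ≫ (leftDerivedSuspensionObjIso G).hom =
      (leftDerivedSuspensionObjIso T).hom ≫ (toHo C).map (suspensionMap f) := by
  simp only [leftDerivedSuspensionObjIso, Iso.trans_hom, asIso_hom, Category.assoc]
  rw [reassoc_of% (leftDerivedSuspensionObjIso'_naturality f), ← Functor.map_comp,
    ← Functor.map_comp, ← suspensionMap_comp, ← suspensionMap_comp,
    fromCofibrantReplacement_naturality]

lemma toHo_map_suspensionMap_eq {T G : C} [IsCofibrant T] [IsCofibrant G] {f g : T ⟶ G}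
    (h : (toHo C).map f = (toHo C).map g) :
    (toHo C).map (suspensionMap f) = (toHo C).map (suspensionMap g) := by
  rw [← cancel_epi (leftDerivedSuspensionObjIso T).hom,
    ← leftDerivedSuspensionObjIso_naturality, ← leftDerivedSuspensionObjIso_naturality, h]

lemma exists_suspension_iso [IsStable C] (Z : Ho C) :
    ∃ (T : C) (_ : IsCofibrant T), Nonempty ((toHo C).obj (cokernel (toCone T)) ≅ Z) := by
  have : (leftDerivedSuspension C).IsEquivalence := IsStable.isEquivalence
  let e := (leftDerivedSuspension C).objObjPreimageIso Z
  let e' := (toHo C).objObjPreimageIso ((leftDerivedSuspension C).objPreimage Z)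
  let T := (toHo C).objPreimage ((leftDerivedSuspension C).objPreimage Z)
  exact ⟨cofibrantReplacement.obj T, inferInstance,
    ⟨(leftDerivedSuspensionObjIso _).symm ≪≫ (leftDerivedSuspension C).mapIso
      (asIso ((toHo C).map (fromCofibrantReplacement T)) ≪≫ e') ≪≫ e⟩⟩

/-- This is fullness of the derived suspension. The conclusion is conditional on a representative
`f` because `G` need not be fibrant, so `φ` need not come from a map in `C`. -/
lemma exists_desuspension [IsStable C] {T G : C} [IsCofibrant T] [IsCofibrant G]
    (ψ : (toHo C).obj (cokernel (toCone T)) ⟶ (toHo C).obj (cokernel (toCone G))) :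
    ∃ φ : (toHo C).obj T ⟶ (toHo C).obj G, ∀ f : T ⟶ G, (toHo C).map f = φ →
      (toHo C).map (suspensionMap f) = ψ := by
  have : (leftDerivedSuspension C).IsEquivalence := IsStable.isEquivalence
  refine ⟨(leftDerivedSuspension C).preimage ((leftDerivedSuspensionObjIso T).hom ≫ ψ ≫
    (leftDerivedSuspensionObjIso G).inv), fun f hf ↦ ?_⟩
  rw [← cancel_epi (leftDerivedSuspensionObjIso T).hom,
    ← leftDerivedSuspensionObjIso_naturality, hf]
  simp

/-- In a stable model category, the map `Σ Ω V ⟶ V` is a weak equivalence. Here, the loop object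
`Ω V` is the fibre of a fibration `p : D ⟶ V` with `D` contractible, and the suspension is formed
using a cofibration `j : G ⟶ N` which resolves the inclusion of this fibre. -/
lemma weakEquivalence_cokernel_desc_of_contractible [HasZeroObject C] [IsStable C] {D V G N : C}
    (p : D ⟶ V) [Fibration p] [IsFibrant V] [WeakEquivalence (terminal.from D)]
    [IsCofibrant G] (j : G ⟶ N) [Cofibration j] (n : N ⟶ D) [Fibration n] [WeakEquivalence n]
    (g : G ⟶ kernel p) [Fibration g] [WeakEquivalence g] (h : g ≫ kernel.ι p = j ≫ n)
    (w : j ≫ n ≫ p = 0) : WeakEquivalence (cokernel.desc j (n ≫ p) w) := by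
  have : IsFibrant D := isFibrant_of_fibration p
  have : IsFibrant N := isFibrant_of_fibration n
  have : WeakEquivalence (terminal.from N) := by
    rw [Subsingleton.elim (terminal.from N) (n ≫ terminal.from D)]
    infer_instance
  have hcone (A : C) : IsFibrant (cone.obj A) := by
    rw [isFibrant_iff, Subsingleton.elim (terminal.from (cone.obj A))
      (factData.factorizationData (terminal.from A)).p]
    exact inferInstanceAs (Fibration (factData.factorizationData (terminal.from A)).p)
  let κ := cokernel.desc j (n ≫ p) w
  have hκ : cokernel.π j ≫ κ = n ≫ p := by simp [κ]
  have ext_cone {T : C} (f : T ⟶ G) : ∃ c : cone.obj T ⟶ N, toCone T ≫ c = f ≫ j := by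
    have sq : CommSq (f ≫ j) (toCone T) (terminal.from N) (terminal.from _) :=
      ⟨Subsingleton.elim _ _⟩
    exact ⟨sq.lift, sq.fac_left⟩
  -- By stability every object of `Ho C` is a suspension, so it suffices that composition with `κ`
  -- is bijective on maps out of suspensions. For surjectivity, the cone is lifted to `D`, and its
  -- restriction to `T` gives a map to the fibre.
  have surj (T : C) [IsCofibrant T] (x : (toHo C).obj (cokernel (toCone T)) ⟶ (toHo C).obj V) :
      ∃ y, y ≫ (toHo C).map κ = x := by
    have : IsCofibrant (cone.obj T) := isCofibrant_of_cofibration (toCone T)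
    obtain ⟨x, rfl⟩ := map_surjective_of_isLocalization (toHo C) _ _ x
    obtain ⟨d, hd⟩ := exists_lift_of_contractible p (cokernel.π (toCone T) ≫ x)
    obtain ⟨f, hf⟩ := exists_lift_of_isCofibrant g
      (kernel.lift p (toCone T ≫ d) (by simp [hd]))
    have sq : CommSq (f ≫ j) (toCone T) n d :=
      ⟨by rw [Category.assoc, ← h, reassoc_of% hf, kernel.lift_ι]⟩
    refine ⟨(toHo C).map (cokernel.map (toCone T) j f sq.lift sq.fac_left), ?_⟩
    rw [← Functor.map_comp]
    congr 1
    ext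
    rw [cokernel.π_desc_assoc, Category.assoc, hκ, sq.fac_right_assoc, hd]
  obtain ⟨θ, hθ⟩ : ∃ θ : N ⟶ cone.obj G, j ≫ θ = 𝟙 G ≫ toCone G := by
    have sq : CommSq (toCone G) j (terminal.from _) (terminal.from _) :=
      ⟨Subsingleton.elim _ _⟩
    exact ⟨sq.lift, by rw [sq.fac_left, Category.id_comp]⟩
  have : WeakEquivalence θ := weakEquivalence_of_contractible θ
  let θ' : cokernel j ⟶ cokernel (toCone G) := cokernel.map j (toCone G) (𝟙 G) θ hθ
  have : WeakEquivalence θ' := weakEquivalence_cokernel_map_id _ _ _ _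
  have hS {T : C} [IsCofibrant T] (f : T ⟶ G) (c : cone.obj T ⟶ N) (hc : toCone T ≫ c = f ≫ j) :
      (toHo C).map (cokernel.map (toCone T) j f c hc) ≫ (toHo C).map θ' =
        (toHo C).map (suspensionMap f) := by
    rw [← Functor.map_comp]
    rw [Category.id_comp] at hθ
    have e : cokernel.map (toCone T) j f c hc ≫ θ' =
        cokernel.map (toCone T) (toCone G) f (c ≫ θ) (by rw [reassoc_of% hc, hθ]) := by
      ext; simp [θ']
    rw [e]
    exact toHo_map_cokernel_map_eq _ _ _ _ _ _ _
  -- Under `θ'`, the cofibre of `j` becomes the suspension of `G`. Fullness of the derived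
  -- suspension then shows that all maps from a suspension to this cofibre come from maps `T ⟶ G`.
  have rep {T : C} [IsCofibrant T] (y : (toHo C).obj (cokernel (toCone T)) ⟶
      (toHo C).obj (cokernel j)) : ∃ (f : T ⟶ G) (c : cone.obj T ⟶ N)
        (hc : toCone T ≫ c = f ≫ j), y = (toHo C).map (cokernel.map (toCone T) j f c hc) := by
    obtain ⟨φ, hφ⟩ := exists_desuspension (y ≫ (toHo C).map θ')
    obtain ⟨f', hf'⟩ := map_surjective_of_isLocalization (toHo C) _ _ (φ ≫ (toHo C).map g)
    obtain ⟨f, rfl⟩ := exists_lift_of_isCofibrant g f'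
    rw [Functor.map_comp, cancel_mono] at hf'
    obtain ⟨c, hc⟩ := ext_cone f
    exact ⟨f, c, hc, by rw [← cancel_mono ((toHo C).map θ'), hS, hφ f hf']⟩
  have inj (T : C) [IsCofibrant T] (y₀ y₁ : (toHo C).obj (cokernel (toCone T)) ⟶
      (toHo C).obj (cokernel j)) (hy : y₀ ≫ (toHo C).map κ = y₁ ≫ (toHo C).map κ) : y₀ = y₁ := by
    obtain ⟨f₀, c₀, h₀, rfl⟩ := rep y₀
    obtain ⟨f₁, c₁, h₁, rfl⟩ := rep y₁
    rw [← Functor.map_comp, ← Functor.map_comp] at hy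
    -- Injectivity: equal composites with `κ` force the maps to the fibre to agree in `Ho C`, and
    -- hence their suspensions.
    have hf : (toHo C).map (f₀ ≫ g) = (toHo C).map (f₁ ≫ g) :=
      toHo_map_eq_of_lifts_of_contractible (toCone T) p hy (c₀ ≫ n) (c₁ ≫ n)
        (by simp [hκ]) (by simp [hκ]) _ _ (by simp [h, reassoc_of% h₀])
        (by simp [h, reassoc_of% h₁])
    rw [Functor.map_comp, Functor.map_comp, cancel_mono] at hf
    rw [← cancel_mono ((toHo C).map θ'), hS, hS, toHo_map_suspensionMap_eq hf]
  have : Mono ((toHo C).map κ) := ⟨fun {Z} a b hab ↦ by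
    obtain ⟨T, _, ⟨e⟩⟩ := exists_suspension_iso Z
    rw [← cancel_epi e.hom]
    exact inj T _ _ (by rw [Category.assoc, Category.assoc, hab])⟩
  have : IsSplitEpi ((toHo C).map κ) := by
    obtain ⟨T, _, ⟨e⟩⟩ := exists_suspension_iso ((toHo C).obj V)
    obtain ⟨y, hy⟩ := surj T e.hom
    exact ⟨⟨e.inv ≫ y, by rw [Category.assoc, hy, e.inv_hom_id]⟩⟩
  have : IsIso ((toHo C).map κ) := isIso_of_mono_of_isSplitEpi _
  exact weakEquivalence_of_isIso_toHo_map κ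

end Counit

/-! ### Fibre sequences are cofibre sequences, and the resulting lifting criterion. -/

section Stable

variable {C : Type u} [Category.{v} C] [ModelCategory C]

lemma exists_contractible_fibration [HasZeroObject C] (X : C) :
    ∃ (P : C) (π : P ⟶ X), Fibration π ∧ WeakEquivalence (terminal.from P) := by
  let F := MorphismProperty.factorizationData (trivialCofibrations C) (fibrations C) (initial.to X)
  have : IsIso (terminal.from (⊥_ C)) :=
    ((isZero_zero C).of_iso HasZeroObject.zeroIsoInitial.symm).isIso
      ((isZero_zero C).of_iso HasZeroObject.zeroIsoTerminal.symm) _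
  exact ⟨F.Z, F.p, inferInstance, weakEquivalence_of_precomp_of_fac
    (f := F.i) (fg := terminal.from (⊥_ C)) (Subsingleton.elim _ _)⟩

lemma exists_cofibration_trivialFibration {X Y : C} (f : X ⟶ Y) :
    ∃ (Z : C) (i : X ⟶ Z) (p : Z ⟶ Y), i ≫ p = f ∧ Cofibration i ∧ Fibration p ∧
      WeakEquivalence p := by
  let F := MorphismProperty.factorizationData (cofibrations C) (trivialFibrations C) f
  exact ⟨F.Z, F.i, F.p, F.fac, inferInstance, inferInstance, inferInstance⟩

variable [HasZeroMorphisms C]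

/-- The cofibre of `⊥_ C ⟶ E` is `E` itself, and replacing `⊥_ C` by the contractible `D` does not
change the cofibre up to weak equivalence. -/
lemma weakEquivalence_cokernel_π_of_contractible [HasZeroObject C] {D E : C} (j : D ⟶ E)
    [Cofibration j] [IsCofibrant D] [WeakEquivalence (terminal.from D)] :
    WeakEquivalence (cokernel.π j) := by
  have := weakEquivalence_initial_to D
  have : IsCofibrant E := isCofibrant_of_cofibration j
  have h : initial.to E ≫ 𝟙 E = initial.to D ≫ j := Subsingleton.elim _ _
  have := weakEquivalence_cokernel_map (initial.to E) j (initial.to D) (𝟙 E) h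
  have h₀ : initial.to E = 0 := Subsingleton.elim _ _
  have : IsIso (cokernel.π (initial.to E)) :=
    ⟨cokernel.desc _ (𝟙 E) (by simp [h₀]), by simp, by ext; simp⟩
  have e : cokernel.π j = cokernel.π (initial.to E) ≫
    cokernel.map (initial.to E) j (initial.to D) (𝟙 E) h := by simp
  rw [e]
  infer_instance

variable [HasZeroObject C] [(cofibrations C).HasFunctorialFactorization (trivialFibrations C)]
  [IsStable C]

/-- In a stable model category, fibre sequences are cofibre sequences: if `p` is a fibration with
fibrant target, and `j` is a cofibration which resolves the inclusion of the fibre of `p`, the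
map from the cofibre of `j` to the target of `p` is a weak equivalence. -/
lemma exists_resolution_of_kernel {X Y : C} (p : X ⟶ Y) [Fibration p] [IsFibrant Y] :
    ∃ (Q' X' : C) (j : Q' ⟶ X') (x : X' ⟶ X) (q : Q' ⟶ kernel p)
      (w : j ≫ x ≫ p = 0), q ≫ kernel.ι p = j ≫ x ∧ IsCofibrant Q' ∧ Cofibration j ∧
        Fibration x ∧ WeakEquivalence x ∧ WeakEquivalence (cokernel.desc j (x ≫ p) w) := by
  have : IsFibrant X := isFibrant_of_fibration p
  -- With `P` contractible, `kernel π` and `kernel (π ≫ p)` are models of `Ω X` and `Ω Y`. Below,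
  -- `kernel (ν ≫ r)` is a model of the loops on the fibre of `p`, and `t`, `s`, `r` continue the
  -- fibre sequence to the left.
  obtain ⟨P, π, _, _⟩ := exists_contractible_fibration X
  let r : kernel (π ≫ p) ⟶ kernel p := kernel.map (π ≫ p) p π (𝟙 Y) (by simp)
  have : Fibration r := fibration_kernel_map_id _ _ _ _
  have hr : r ≫ kernel.ι p = kernel.ι (π ≫ p) ≫ π := by simp [r]
  let s : kernel π ⟶ kernel (π ≫ p) := kernel.lift _ (kernel.ι π) (by simp)
  have hs : s ≫ kernel.ι (π ≫ p) = kernel.ι π := by simp [s]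
  have hsr : s ≫ r = 0 := by ext; simp [hr, reassoc_of% hs]
  obtain ⟨N, ν, _, _⟩ := exists_contractible_fibration (kernel (π ≫ p))
  let t : kernel (ν ≫ r) ⟶ kernel π :=
    kernel.lift _ (kernel.ι (ν ≫ r) ≫ ν ≫ kernel.ι (π ≫ p)) (by
      simp only [Category.assoc]
      rw [← hr, ← Category.assoc ν r, ← Category.assoc, kernel.condition, zero_comp])
  have ht : t ≫ s = kernel.ι (ν ≫ r) ≫ ν := by ext; simp [hs, t]
  obtain ⟨T', o, τ, -, ho, _, _⟩ := exists_cofibration_trivialFibration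
    (initial.to (kernel (ν ≫ r)))
  have : IsCofibrant T' := by rwa [isCofibrant_iff, Subsingleton.elim (initial.to T') o]
  obtain ⟨S', a, σ, ha, _, _, _⟩ := exists_cofibration_trivialFibration (τ ≫ t)
  have : IsCofibrant S' := isCofibrant_of_cofibration a
  obtain ⟨N', b, n, hb, _, _, _⟩ := exists_cofibration_trivialFibration (τ ≫ kernel.ι (ν ≫ r))
  -- The sequence is resolved by cofibrations. Factoring out of a pushout here, and for `Q'` out of
  -- a cofibre, keeps the composite `sR ≫ e` strictly zero and makes the comparison map `f` below a
  -- cofibration.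
  obtain ⟨R', m, ρ, hm, _, _, _⟩ := exists_cofibration_trivialFibration
    (pushout.desc (f := b) (g := a) (n ≫ ν) (σ ≫ s)
      (by rw [reassoc_of% hb, reassoc_of% ha, ht]))
  let sR : S' ⟶ R' := pushout.inr b a ≫ m
  have : Cofibration sR := by dsimp only [sR]; infer_instance
  have hsR : sR ≫ ρ = σ ≫ s := by simp [sR, hm, pushout.inr_desc]
  have hnR : pushout.inl b a ≫ m ≫ ρ = n ≫ ν := by simp [hm, pushout.inl_desc]
  have : IsCofibrant R' := isCofibrant_of_cofibration sR
  obtain ⟨P', c, y, hc, _, _, _⟩ := exists_cofibration_trivialFibration (ρ ≫ kernel.ι (π ≫ p))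
  obtain ⟨Q', d, q, hd, _, _, _⟩ := exists_cofibration_trivialFibration
    (cokernel.desc sR (ρ ≫ r) (by rw [reassoc_of% hsR, hsr, comp_zero]))
  have : IsCofibrant Q' := isCofibrant_of_cofibration d
  let e : R' ⟶ Q' := cokernel.π sR ≫ d
  have he : e ≫ q = ρ ≫ r := by simp [e, hd]
  have hse : sR ≫ e = 0 := by simp [e]
  obtain ⟨X', l, x, hl, _, _, _⟩ := exists_cofibration_trivialFibration
    (pushout.desc (f := e) (g := c) (q ≫ kernel.ι p) (y ≫ π)
      (by rw [reassoc_of% he, hr, reassoc_of% hc]))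
  let j : Q' ⟶ X' := pushout.inl e c ≫ l
  let k : P' ⟶ X' := pushout.inr e c ≫ l
  have : Cofibration j := by dsimp only [j]; infer_instance
  have hj : q ≫ kernel.ι p = j ≫ x := by simp [j, hl, pushout.inl_desc]
  have hk : k ≫ x = y ≫ π := by simp [k, hl, pushout.inr_desc]
  have hejk : e ≫ j = c ≫ k := by simp [j, k, pushout.condition_assoc]
  have wj : j ≫ x ≫ p = 0 := by rw [← reassoc_of% hj, kernel.condition, comp_zero]
  have w₁ : c ≫ y ≫ π ≫ p = 0 := by rw [reassoc_of% hc, kernel.condition, comp_zero]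
  -- The equivalence `Σ Ω V ⟶ V` is applied to `Y`, to `X`, and to the fibre of `p`.
  have h₁ : WeakEquivalence (cokernel.desc c (y ≫ π ≫ p) w₁) :=
    weakEquivalence_cokernel_desc_of_contractible (π ≫ p) c y ρ hc.symm w₁
  have h₂' : σ ≫ kernel.ι π = (sR ≫ c) ≫ y := by
    rw [Category.assoc, hc, reassoc_of% hsR, hs]
  have w₂ : (sR ≫ c) ≫ y ≫ π = 0 := by
    rw [← Category.assoc, ← h₂', Category.assoc, kernel.condition, comp_zero]
  have h₂ : WeakEquivalence (cokernel.desc (sR ≫ c) (y ≫ π) w₂) :=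
    weakEquivalence_cokernel_desc_of_contractible π (sR ≫ c) y σ h₂' w₂
  have w₃ : b ≫ n ≫ ν ≫ r = 0 := by rw [reassoc_of% hb, kernel.condition, comp_zero]
  have h₃ : WeakEquivalence (cokernel.desc b (n ≫ ν ≫ r) w₃) :=
    weakEquivalence_cokernel_desc_of_contractible (ν ≫ r) b n τ hb.symm w₃
  let u₂ : cokernel (sR ≫ c) ⟶ X' := cokernel.desc _ k
    (by rw [Category.assoc, ← hejk, reassoc_of% hse, zero_comp])
  have hu₂ : u₂ ≫ x = cokernel.desc (sR ≫ c) (y ≫ π) w₂ := by ext; simp [u₂, hk]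
  have : WeakEquivalence u₂ := weakEquivalence_of_postcomp_of_fac hu₂
  let f : cokernel (pushout.inr b a) ⟶ Q' :=
    cokernel.map (pushout.inr b a) sR (𝟙 S') m (by simp [sR]) ≫ d
  have : Cofibration (cokernel.map (pushout.inr b a) sR (𝟙 S') m (by simp [sR])) :=
    cofibration_cokernel_map_id _ _ _ _
  have : Cofibration f := by dsimp only [f]; infer_instance
  have := isIso_cokernel_map_pushout b a
  have hf : cokernel.map b (pushout.inr b a) a (pushout.inl b a) pushout.condition ≫ f ≫ q =
      cokernel.desc b (n ≫ ν ≫ r) w₃ := by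
    ext; simp [f, hd, reassoc_of% hnR]
  have : WeakEquivalence (f ≫ q) := weakEquivalence_of_precomp_of_fac hf
  have : WeakEquivalence f := weakEquivalence_of_postcomp f q
  let a₀ : cokernel (pushout.inr b a) ⟶ cokernel (sR ≫ c) :=
    cokernel.map (pushout.inr b a) (sR ≫ c) (𝟙 S') (m ≫ c) (by simp [sR])
  have : Cofibration a₀ := cofibration_cokernel_map_id _ _ _ _
  have h₀ : a₀ ≫ u₂ = f ≫ j := by
    rw [← cancel_epi (cokernel.π (pushout.inr b a))]
    simp [a₀, u₂, f, ← hejk, e]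
  have := weakEquivalence_cokernel_map a₀ j f u₂ h₀
  -- Here `α ≫ β` is the map from the cofibre of `Σ Ω F ⟶ Σ Ω X` to that of `F ⟶ X`, where `F` is
  -- the fibre of `p`. The composite of `β` with the map in question is the equivalence `Σ Ω Y ⟶ Y`.
  -- Two-out-of-six concludes.
  let α : cokernel a₀ ⟶ cokernel c := cokernel.desc a₀
    (cokernel.map (sR ≫ c) c sR (𝟙 P') (by simp)) (by
      rw [← cancel_epi (cokernel.π (pushout.inr b a))]
      simp [a₀])
  let β : cokernel c ⟶ cokernel j := cokernel.map c j e k hejk.symm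
  have hαβ : α ≫ β = cokernel.map a₀ j f u₂ h₀ := by
    ext; simp [α, β, u₂]
  have hβγ : β ≫ cokernel.desc j (x ≫ p) wj = cokernel.desc c (y ≫ π ≫ p) w₁ := by
    ext; simp [β, reassoc_of% hk]
  have : WeakEquivalence (α ≫ β) := by rw [hαβ]; infer_instance
  have : WeakEquivalence (β ≫ cokernel.desc j (x ≫ p) wj) := by rw [hβγ]; infer_instance
  exact ⟨Q', X', j, x, q, wj, hj, inferInstance, inferInstance, inferInstance, inferInstance,
    weakEquivalence_of_two_out_of_six α β _⟩

/-- In a stable model category, if a square from a fibration `p` with fibrant target to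
a fibration `p'` induces the trivial map of fibres in the homotopy category, then the square
has a lift after restriction to a cofibration with cofibrant source which is weakly equivalent
to `p`. -/
lemma exists_lift_of_toHo_map_kernel_map_eq_zero {A B X Y X' Y' : C} (i : A ⟶ B) [Cofibration i]
    [IsCofibrant A] (a : A ⟶ X) (b : B ⟶ Y) (p : X ⟶ Y) [Fibration p] [IsFibrant Y]
    (hab : a ≫ p = i ≫ b) (p' : X' ⟶ Y') [Fibration p'] (f : X ⟶ X') (g : Y ⟶ Y')
    (hfg : p ≫ g = f ≫ p')
    (h : (toHo C).map (kernel.map p p' f g hfg) = (toHo C).map 0) :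
    ∃ l : B ⟶ X', i ≫ l = a ≫ f ∧ l ≫ p' = b ≫ g := by
  obtain ⟨Q, Z, j, x, q, w, hq, _, _, _, _, _⟩ := exists_resolution_of_kernel p
  obtain ⟨a', ha'⟩ := exists_lift_of_isCofibrant x a
  obtain ⟨d, hd⟩ := exists_extension_of_toHo_map_eq_zero (q ≫ kernel.map p p' f g hfg)
    (by rw [Functor.map_comp, h, ← Functor.map_comp, comp_zero]) (toCone Q)
  have hd' : toCone Q ≫ d ≫ kernel.ι p' = j ≫ x ≫ f := by
    rw [reassoc_of% hd, kernel.lift_ι, reassoc_of% hq]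
  -- The mapping cone of `j` is equivalent to its cofibre, because the attached cone is
  -- contractible; hence `ε` is a weak equivalence.
  let ε : pushout j (toCone Q) ⟶ Y := pushout.desc (x ≫ p) 0 (by simp [w])
  have : IsCofibrant (cone.obj Q) := isCofibrant_of_cofibration (toCone Q)
  have := weakEquivalence_cokernel_π_of_contractible (pushout.inr j (toCone Q))
  have := isIso_cokernel_map_pushout j (toCone Q)
  let κ : cokernel (pushout.inr j (toCone Q)) ⟶ Y :=
    cokernel.desc _ ε (by simp [ε, pushout.inr_desc])
  have hκ : cokernel.map j _ _ _ (pushout.condition (f := j) (g := toCone Q)) ≫ κ =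
      cokernel.desc j (x ≫ p) w := by
    ext; simp [κ, ε, pushout.inl_desc]
  have : WeakEquivalence κ := weakEquivalence_of_precomp_of_fac hκ
  have hε : cokernel.π (pushout.inr j (toCone Q)) ≫ κ = ε := by simp [κ]
  have : WeakEquivalence ε := by rw [← hε]; infer_instance
  -- The cofibration `i` lifts against the trivial fibration `z`, giving `B ⟶ E`. The map from the
  -- mapping cone to `X'` extends over the trivial cofibration `c`, giving `E ⟶ X'`.
  obtain ⟨E, c, z, hcz, _, _, _⟩ := exists_cofibration_trivialFibration ε
  have : WeakEquivalence c := weakEquivalence_of_postcomp_of_fac hcz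
  have sq : CommSq (a' ≫ pushout.inl j (toCone Q) ≫ c) i z b := ⟨by
    rw [Category.assoc, Category.assoc, hcz, ← hab, ← ha']
    simp [ε, pushout.inl_desc]⟩
  have sq' : CommSq (pushout.desc (f := j) (g := toCone Q) (x ≫ f) (d ≫ kernel.ι p') hd'.symm)
      c p' (z ≫ g) := ⟨by
    rw [reassoc_of% hcz]
    ext
    · simp [ε, pushout.inl_desc_assoc, hfg]
    · simp [ε, pushout.inr_desc_assoc]⟩
  refine ⟨sq.lift ≫ sq'.lift, ?_, ?_⟩
  · rw [sq.fac_left_assoc, Category.assoc, Category.assoc, sq'.fac_left, pushout.inl_desc,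
      reassoc_of% ha']
  · rw [Category.assoc, sq'.fac_right, sq.fac_right_assoc]

end Stable

/-! ### Homotopy invariance of fibres and of lifting problems. -/

section Kernel

variable {C : Type u} [Category.{v} C] [ModelCategory C]

section

variable [HasZeroMorphisms C]

lemma weakEquivalence_kernel_map_of_fibration {B P Z : C} (p : P ⟶ B) (u : P ⟶ Z) (q : Z ⟶ B)
    (h : p ≫ 𝟙 B = u ≫ q) [Fibration u] [WeakEquivalence u] :
    WeakEquivalence (kernel.map p q u (𝟙 B) h) := by
  rw [weakEquivalence_iff]
  exact (MorphismProperty.of_isPullback (isPullback_kernel_map_id p u q h).flip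
    (mem_trivialFibrations u)).2

/-- A weak equivalence between fibrations with the same target induces a weak equivalence of
fibres. -/
lemma weakEquivalence_kernel_map_id {B P Q : C} (p : P ⟶ B) (g : P ⟶ Q) (q : Q ⟶ B)
    (h : p ≫ 𝟙 B = g ≫ q) [Fibration p] [Fibration q] [WeakEquivalence g] :
    WeakEquivalence (kernel.map p q g (𝟙 B) h) := by
  rw [Category.comp_id] at h
  let F := MorphismProperty.factorizationData (trivialCofibrations C) (fibrations C)
    (pullback.lift (𝟙 P) g (by simp [h]) : P ⟶ pullback p q)
  let a : F.Z ⟶ P := F.p ≫ pullback.fst p q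
  let b : F.Z ⟶ Q := F.p ≫ pullback.snd p q
  have ha : F.i ≫ a = 𝟙 P := by simp [a, pullback.lift_fst]
  have hb : F.i ≫ b = g := by simp [b, pullback.lift_snd]
  have : WeakEquivalence a := weakEquivalence_of_precomp_of_fac ha
  have : WeakEquivalence b := weakEquivalence_of_precomp_of_fac hb
  have : Fibration a := by dsimp only [a]; infer_instance
  have : Fibration b := by dsimp only [b]; infer_instance
  have h₁ : (a ≫ p) ≫ 𝟙 B = a ≫ p := by simp
  have h₂ : (a ≫ p) ≫ 𝟙 B = b ≫ q := by simp [a, b, pullback.condition]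
  have h₃ : p ≫ 𝟙 B = F.i ≫ a ≫ p := by simp [reassoc_of% ha]
  have w₁ := weakEquivalence_kernel_map_of_fibration (a ≫ p) a p h₁
  have w₂ := weakEquivalence_kernel_map_of_fibration (a ≫ p) b q h₂
  have w₃ : WeakEquivalence (kernel.map p (a ≫ p) F.i (𝟙 B) h₃) := by
    refine weakEquivalence_of_postcomp_of_fac
      (g := kernel.map (a ≫ p) p a (𝟙 B) h₁) (fg := 𝟙 _) ?_
    ext
    simp [ha]
  have e : kernel.map p q g (𝟙 B) (by simpa using h) =
      kernel.map p (a ≫ p) F.i (𝟙 B) h₃ ≫ kernel.map (a ≫ p) q b (𝟙 B) h₂ := by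
    ext
    simp [hb]
  rw [e]
  infer_instance

/-- The fibre is unchanged by base change. -/
lemma isIso_kernel_map_pullback {X Y B : C} (p : X ⟶ Y) (f : B ⟶ Y) :
    IsIso (kernel.map (pullback.snd p f) p (pullback.fst p f) f pullback.condition.symm) := by
  refine ⟨kernel.lift _ (pullback.lift (kernel.ι p) 0 (by simp))
    (by simp [pullback.lift_snd]), ?_, ?_⟩
  · ext <;> simp [pullback.lift_fst, pullback.lift_snd]
  · ext; simp [pullback.lift_fst]

/-- A weak equivalence between fibrations such that the map of targets is a trivial fibration
induces a weak equivalence of fibres. -/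
lemma weakEquivalence_kernel_map_of_trivialFibration {X Y X' Y' : C} (p : X ⟶ Y) (p' : X' ⟶ Y')
    (g : X ⟶ X') (f : Y ⟶ Y') (h : p ≫ f = g ≫ p') [Fibration p] [Fibration p'] [Fibration f]
    [WeakEquivalence f] [WeakEquivalence g] : WeakEquivalence (kernel.map p p' g f h) := by
  let d : X ⟶ pullback p' f := pullback.lift g p h.symm
  have hd : d ≫ pullback.fst p' f = g := by simp [d, pullback.lift_fst]
  have hd' : p ≫ 𝟙 Y = d ≫ pullback.snd p' f := by simp [d, pullback.lift_snd]
  have : WeakEquivalence d := weakEquivalence_of_postcomp_of_fac hd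
  have := weakEquivalence_kernel_map_id p d (pullback.snd p' f) hd'
  have := isIso_kernel_map_pullback p' f
  have e : kernel.map p p' g f h = kernel.map p (pullback.snd p' f) d (𝟙 Y) hd' ≫
      kernel.map (pullback.snd p' f) p' (pullback.fst p' f) f pullback.condition.symm := by
    ext
    simp [hd]
  rw [e]
  infer_instance

/-- A weak equivalence between fibrations with fibrant targets induces a weak equivalence of
fibres. -/
lemma weakEquivalence_kernel_map {X Y X' Y' : C} (p : X ⟶ Y) (p' : X' ⟶ Y')
    (g : X ⟶ X') (f : Y ⟶ Y') (h : p ≫ f = g ≫ p') [Fibration p] [Fibration p'] [IsFibrant Y]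
    [IsFibrant Y'] [WeakEquivalence f] [WeakEquivalence g] :
    WeakEquivalence (kernel.map p p' g f h) := by
  let F : FibrantBrownFactorization f := Classical.arbitrary _
  have : Fibration F.p := by simpa only [fibration_iff] using F.hp
  have : WeakEquivalence F.p := weakEquivalence_of_precomp_of_fac F.fac
  -- The fibration `q` over `F.Z` maps to both `p` and `p'` by weak equivalences covering the
  -- trivial fibrations `F.r` and `F.p`, which reduces the claim to the preceding case.
  let G := MorphismProperty.factorizationData (trivialCofibrations C) (fibrations C)
    (pullback.lift (prod.lift (𝟙 X) g) (p ≫ F.i) (by ext <;> simp [h]) :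
      X ⟶ pullback (prod.map p p') (prod.lift F.r F.p))
  let q : G.Z ⟶ F.Z := G.p ≫ pullback.snd _ _
  let a : G.Z ⟶ X := G.p ≫ pullback.fst _ _ ≫ prod.fst
  let b : G.Z ⟶ X' := G.p ≫ pullback.fst _ _ ≫ prod.snd
  have hq : G.i ≫ q = p ≫ F.i := by simp [q, pullback.lift_snd]
  have ha : G.i ≫ a = 𝟙 X := by simp [a, pullback.lift_fst_assoc, prod.lift_fst]
  have hb : G.i ≫ b = g := by simp [b, pullback.lift_fst_assoc, prod.lift_snd]
  have hqa : q ≫ F.r = a ≫ p := by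
    have := pullback.condition (f := prod.map p p') (g := prod.lift F.r F.p) =≫ prod.fst
    simp only [Category.assoc, prod.map_fst, prod.lift_fst] at this
    simp [q, a, this]
  have hqb : q ≫ F.p = b ≫ p' := by
    have := pullback.condition (f := prod.map p p') (g := prod.lift F.r F.p) =≫ prod.snd
    simp only [Category.assoc, prod.map_snd, prod.lift_snd] at this
    simp [q, b, this]
  have : Fibration q := by dsimp only [q]; infer_instance
  have : WeakEquivalence a := weakEquivalence_of_precomp_of_fac ha
  have : WeakEquivalence b := weakEquivalence_of_precomp_of_fac hb
  have := weakEquivalence_kernel_map_of_trivialFibration q p a F.r hqa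
  have := weakEquivalence_kernel_map_of_trivialFibration q p' b F.p hqb
  have : WeakEquivalence (kernel.map p q G.i F.i hq.symm) := by
    refine weakEquivalence_of_postcomp_of_fac (g := kernel.map q p a F.r hqa) (fg := 𝟙 _) ?_
    ext
    simp [ha]
  have e : kernel.map p p' g f h = kernel.map p q G.i F.i hq.symm ≫ kernel.map q p' b F.p hqb := by
    ext
    simp [hb]
  rw [e]
  infer_instance

end

/-- Lifting problems for a cofibration do not distinguish weakly equivalent fibrations with the
same target. -/
lemma exists_lift_of_weakEquivalence_over {A B X X' Y : C} (i : A ⟶ B) [Cofibration i] (p : X ⟶ Y)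
    [Fibration p] (u : X ⟶ X') [WeakEquivalence u] (q : X' ⟶ Y) (hu : u ≫ q = p) (a : A ⟶ X)
    (l : B ⟶ X') (hl : i ≫ l = a ≫ u) : ∃ l' : B ⟶ X, i ≫ l' = a ∧ l' ≫ p = l ≫ q := by
  let F := MorphismProperty.factorizationData (cofibrations C) (trivialFibrations C) u
  have : WeakEquivalence F.i := weakEquivalence_of_postcomp_of_fac F.fac
  have sq : CommSq (a ≫ F.i) i F.p l := ⟨by simp [hl]⟩
  have sq' : CommSq (𝟙 X) F.i p (F.p ≫ q) := ⟨by simp [hu]⟩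
  exact ⟨sq.lift ≫ sq'.lift, by simp, by simp⟩

/-- Lifting problems for a fibration do not distinguish weakly equivalent cofibrations with the
same source. -/
lemma exists_lift_of_weakEquivalence_under {A B E X Y : C} (i : A ⟶ B) [Cofibration i] (j : A ⟶ E)
    (e : E ⟶ B) [WeakEquivalence e] (he : j ≫ e = i) (p : X ⟶ Y) [Fibration p] (b : B ⟶ Y)
    (l : E ⟶ X) (hl : l ≫ p = e ≫ b) : ∃ l' : B ⟶ X, i ≫ l' = j ≫ l ∧ l' ≫ p = b := by
  let F := MorphismProperty.factorizationData (cofibrations C) (trivialFibrations C) e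
  have : WeakEquivalence F.i := weakEquivalence_of_postcomp_of_fac F.fac
  have sq : CommSq (j ≫ F.i) i F.p (𝟙 B) := ⟨by simp [he]⟩
  have sq' : CommSq l F.i p (F.p ≫ b) := ⟨by simp [hl]⟩
  exact ⟨sq.lift ≫ sq'.lift, by simp, by simp⟩

end Kernel

lemma fibreMap_comp {C : Type u} [Category.{v} C] [ModelCategory C] [HasZeroMorphisms C]
    {p q r : Arrow C} (φ : p ⟶ q) (ψ : q ⟶ r) :
    fibreMap (φ ≫ ψ) = fibreMap φ ≫ fibreMap ψ := by
  ext
  simp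

/-! ### Functorial replacement by fibrations with fibrant target. -/

section Replacement

variable {C : Type u} [Category.{v} C] [ModelCategory C]
  [(trivialCofibrations C).HasFunctorialFactorization (fibrations C)]

/-- The functorial factorization of maps as a trivial cofibration followed by a fibration. -/
noncomputable abbrev fibFactData :
    (trivialCofibrations C).FunctorialFactorizationData (fibrations C) :=
  MorphismProperty.functorialFactorizationData _ _

/-- The functorial fibrant replacement. -/
noncomputable def fibrantReplacement : C ⥤ C where
  obj X := (fibFactData.factorizationData (terminal.from X)).Z
  map {X Y} f := fibFactData.mapZ (Arrow.homMk f (𝟙 _) (by simp) :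
    Arrow.mk (terminal.from X) ⟶ Arrow.mk (terminal.from Y))
  map_id X := by
    rw [← MorphismProperty.FunctorialFactorizationData.mapZ_id]
    rfl
  map_comp f g := by
    rw [← MorphismProperty.FunctorialFactorizationData.mapZ_comp]
    congr 1
    ext <;> simp

/-- The trivial cofibration to the fibrant replacement. -/
noncomputable def toFibrantReplacement (X : C) : X ⟶ fibrantReplacement.obj X :=
  (fibFactData.factorizationData (terminal.from X)).i

lemma toFibrantReplacement_naturality {X Y : C} (f : X ⟶ Y) :
    toFibrantReplacement X ≫ fibrantReplacement.map f = f ≫ toFibrantReplacement Y :=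
  fibFactData.i_mapZ (Arrow.homMk f (𝟙 _) (by simp) :
    Arrow.mk (terminal.from X) ⟶ Arrow.mk (terminal.from Y))

instance (X : C) : Cofibration (toFibrantReplacement X) :=
  inferInstanceAs (Cofibration (fibFactData.factorizationData (terminal.from X)).i)

instance (X : C) : WeakEquivalence (toFibrantReplacement X) :=
  inferInstanceAs (WeakEquivalence (fibFactData.factorizationData (terminal.from X)).i)

instance (X : C) : IsFibrant (fibrantReplacement.obj X) := by
  rw [isFibrant_iff, Subsingleton.elim (terminal.from (fibrantReplacement.obj X))
    (fibFactData.factorizationData (terminal.from X)).p]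
  exact inferInstanceAs (Fibration (fibFactData.factorizationData (terminal.from X)).p)

/-- The source of the replacement of a map by a fibration with fibrant target. -/
noncomputable def replacementSource (p : Arrow C) : C :=
  (fibFactData.factorizationData (p.hom ≫ toFibrantReplacement p.right)).Z

/-- The replacement of a map by a fibration with fibrant target. -/
noncomputable def replacementMap (p : Arrow C) :
    replacementSource p ⟶ fibrantReplacement.obj p.right :=
  (fibFactData.factorizationData (p.hom ≫ toFibrantReplacement p.right)).p

/-- The trivial cofibration to the source of the replacement of a map. -/
noncomputable def toReplacementSource (p : Arrow C) : p.left ⟶ replacementSource p :=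
  (fibFactData.factorizationData (p.hom ≫ toFibrantReplacement p.right)).i

instance (p : Arrow C) : Fibration (replacementMap p) :=
  inferInstanceAs (Fibration
    (fibFactData.factorizationData (p.hom ≫ toFibrantReplacement p.right)).p)

instance (p : Arrow C) : Cofibration (toReplacementSource p) :=
  inferInstanceAs (Cofibration
    (fibFactData.factorizationData (p.hom ≫ toFibrantReplacement p.right)).i)

instance (p : Arrow C) : WeakEquivalence (toReplacementSource p) :=
  inferInstanceAs (WeakEquivalence
    (fibFactData.factorizationData (p.hom ≫ toFibrantReplacement p.right)).i)

lemma toReplacementSource_replacementMap (p : Arrow C) :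
    toReplacementSource p ≫ replacementMap p = p.hom ≫ toFibrantReplacement p.right :=
  (fibFactData.factorizationData (p.hom ≫ toFibrantReplacement p.right)).fac

/-- The map of arrows from which the functoriality of the replacement is deduced. -/
noncomputable def replacementArrowMap {p q : Arrow C} (φ : p ⟶ q) :
    Arrow.mk (p.hom ≫ toFibrantReplacement p.right) ⟶
      Arrow.mk (q.hom ≫ toFibrantReplacement q.right) :=
  Arrow.homMk φ.left (fibrantReplacement.map φ.right)
    (by simp [toFibrantReplacement_naturality])

/-- The functoriality of the sources of the replacements. -/
noncomputable def replacementSourceMap {p q : Arrow C} (φ : p ⟶ q) :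
    replacementSource p ⟶ replacementSource q :=
  fibFactData.mapZ (replacementArrowMap φ)

lemma replacementSourceMap_comp {p q r : Arrow C} (φ : p ⟶ q) (ψ : q ⟶ r) :
    replacementSourceMap (φ ≫ ψ) = replacementSourceMap φ ≫ replacementSourceMap ψ := by
  have h : replacementArrowMap (φ ≫ ψ) = replacementArrowMap φ ≫ replacementArrowMap ψ := by
    ext <;> simp [replacementArrowMap]
  exact (congrArg fibFactData.mapZ h).trans
    (MorphismProperty.FunctorialFactorizationData.mapZ_comp _ _ _)

lemma toReplacementSource_naturality {p q : Arrow C} (φ : p ⟶ q) :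
    toReplacementSource p ≫ replacementSourceMap φ = φ.left ≫ toReplacementSource q :=
  fibFactData.i_mapZ (replacementArrowMap φ)

lemma replacementMap_naturality {p q : Arrow C} (φ : p ⟶ q) :
    replacementSourceMap φ ≫ replacementMap q =
      replacementMap p ≫ fibrantReplacement.map φ.right :=
  fibFactData.mapZ_p (replacementArrowMap φ)

/-- The map between the replacements of two maps. -/
noncomputable abbrev replacementHom {p q : Arrow C} (φ : p ⟶ q) :
    Arrow.mk (replacementMap p) ⟶ Arrow.mk (replacementMap q) :=
  Arrow.homMk (replacementSourceMap φ) (fibrantReplacement.map φ.right)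
    (replacementMap_naturality φ)

lemma replacementHom_comp {p q r : Arrow C} (φ : p ⟶ q) (ψ : q ⟶ r) :
    replacementHom (φ ≫ ψ) = replacementHom φ ≫ replacementHom ψ := by
  ext <;> simp [replacementSourceMap_comp]

/-- The map from a map to its replacement. -/
noncomputable abbrev toReplacement (p : Arrow C) : p ⟶ Arrow.mk (replacementMap p) :=
  Arrow.homMk (toReplacementSource p) (toFibrantReplacement p.right)
    (toReplacementSource_replacementMap p)

lemma toReplacement_naturality {p q : Arrow C} (φ : p ⟶ q) :
    toReplacement p ≫ replacementHom φ = φ ≫ toReplacement q := by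
  ext <;> simp [toReplacementSource_naturality, toFibrantReplacement_naturality]

variable [HasZeroMorphisms C]

/-- A class of maps such that the replacement by fibrations with fibrant targets does not change
the homotopy type of the fibres, nor the solvability of lifting problems. -/
structure IsReplaceable (S : MorphismProperty C) : Prop where
  isIso (p : Arrow C) : S p.hom → IsIso ((toHo C).map (fibreMap (toReplacement p)))
  exists_lift (p : Arrow C) : S p.hom → ∀ {A B : C} (i : A ⟶ B) (_ : Cofibration i)
    (sq : Arrow.mk i ⟶ p) (l : B ⟶ replacementSource p),
      i ≫ l = sq.left ≫ toReplacementSource p →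
      l ≫ replacementMap p = sq.right ≫ toFibrantReplacement p.right →
      ∃ l' : B ⟶ p.left, i ≫ l' = sq.left ∧ l' ≫ p.hom = sq.right

lemma isReplaceable_fibrationsWithFibrantTarget :
    IsReplaceable (fibrationsWithFibrantTarget C) where
  isIso p hp := by
    obtain ⟨_, _⟩ := hp
    have : WeakEquivalence (fibreMap (toReplacement p)) := 
      weakEquivalence_kernel_map p.hom (replacementMap p) (toReplacementSource p)
        (toFibrantReplacement p.right) (toReplacementSource_replacementMap p).symm
    infer_instance
  exists_lift p hp A B i hi sq l hl hl' := by
    obtain ⟨_, _⟩ := hp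
    have sq₁ : CommSq (𝟙 p.right) (toFibrantReplacement p.right) (terminal.from p.right)
      (terminal.from _) := ⟨Subsingleton.elim _ _⟩
    -- The lifts of both squares exhibit `p` as a retract of its replacement, so lifts can be
    -- carried back.
    have sq₂ : CommSq (𝟙 p.left) (toReplacementSource p) p.hom
        (replacementMap p ≫ sq₁.lift) := ⟨by
      rw [← Category.assoc, toReplacementSource_replacementMap, Category.assoc, sq₁.fac_left]
      simp⟩
    refine ⟨l ≫ sq₂.lift, ?_, ?_⟩
    · rw [reassoc_of% hl, sq₂.fac_left, Category.comp_id]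
    · rw [Category.assoc, sq₂.fac_right, reassoc_of% hl', sq₁.fac_left, Category.comp_id]

/-- By right properness, `p` is weakly equivalent over its own target to the base change of its
replacement. That base change has the same fibre as the replacement. -/
lemma isReplaceable_fibrations (hC : IsRightProper C) : IsReplaceable (fibrations C) := by
  have key (p : Arrow C) : WeakEquivalence (pullback.lift (toReplacementSource p) p.hom
      (toReplacementSource_replacementMap p) :
        p.left ⟶ pullback (replacementMap p) (toFibrantReplacement p.right)) := by
    have := hC.weakEquivalence_of_isPullback
      (IsPullback.of_hasPullback (replacementMap p) (toFibrantReplacement p.right))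
      inferInstance inferInstance
    exact weakEquivalence_of_postcomp_of_fac (pullback.lift_fst _ _ _)
  refine ⟨fun p hp ↦ ?_, fun p hp A B i hi sq l hl hl' ↦ ?_⟩
  · have := key p
    have : Fibration p.hom := ⟨hp⟩
    let d : p.left ⟶ pullback (replacementMap p) (toFibrantReplacement p.right) :=
      pullback.lift (toReplacementSource p) p.hom (toReplacementSource_replacementMap p)
    have hd : p.hom ≫ 𝟙 _ = d ≫ pullback.snd _ _ := by simp [d, pullback.lift_snd]
    have := weakEquivalence_kernel_map_id p.hom d (pullback.snd _ _) hd
    have := isIso_kernel_map_pullback (replacementMap p) (toFibrantReplacement p.right)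
    have e : fibreMap (toReplacement p) = kernel.map p.hom (pullback.snd _ _) d (𝟙 _) hd ≫
        kernel.map _ (replacementMap p) (pullback.fst _ (toFibrantReplacement p.right)) _
          pullback.condition.symm := by
      ext
      simp [d, pullback.lift_fst]
      exact kernel.lift_ι _ _ _
    rw [e]
    infer_instance
  · have := key p
    have : Fibration p.hom := ⟨hp⟩
    obtain ⟨l', h₁, h₂⟩ := exists_lift_of_weakEquivalence_over i p.hom
      (pullback.lift (toReplacementSource p) p.hom (toReplacementSource_replacementMap p))
      (pullback.snd _ _) (pullback.lift_snd _ _ _) sq.left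
      (pullback.lift l sq.right hl') (by
        have := sq.w
        ext <;> simp_all [pullback.lift_fst, pullback.lift_snd])
    exact ⟨l', h₁, by rw [h₂, pullback.lift_snd]⟩

end Replacement

/-! ### Construction of the obstruction theories. -/

section Main

variable {C : Type u} [Category.{v} C] [ModelCategory C] [HasZeroObject C] [HasZeroMorphisms C]
  [(cofibrations C).HasFunctorialFactorization (trivialFibrations C)]
  [(trivialCofibrations C).HasFunctorialFactorization (fibrations C)]

/-- The obstruction theory for cofibrations with cofibrant source in a stable model category. The
obstruction attached to a square is the induced map of homotopy fibres. -/
noncomputable def relativeObstructionTheory [IsStable C] {S : MorphismProperty C}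
    (hS : IsReplaceable S) {A B : C} (i : A ⟶ B) [Cofibration i] [IsCofibrant A] :
    RelativeObstructionTheory S i where
  W := fibre (Arrow.mk (replacementMap (Arrow.mk i)))
  obstruction p hp sq :=
    have := hS.isIso p hp
    (toHo C).map (fibreMap (replacementHom sq)) ≫ inv ((toHo C).map (fibreMap (toReplacement p)))
  obstruction_eq_zero_iff p hp sq := by
    have := hS.isIso p hp
    rw [IsIso.comp_inv_eq, ← Functor.map_comp, zero_comp]
    constructor
    · intro h
      obtain ⟨l, h₁, h₂⟩ := exists_lift_of_toHo_map_kernel_map_eq_zero i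
        (toReplacementSource (Arrow.mk i)) (toFibrantReplacement B)
        (replacementMap (Arrow.mk i)) (toReplacementSource_replacementMap (Arrow.mk i))
        (replacementMap p) (replacementSourceMap sq) (fibrantReplacement.map sq.right)
        (replacementMap_naturality sq).symm h
      rw [toReplacementSource_naturality] at h₁
      rw [toFibrantReplacement_naturality] at h₂
      exact hS.exists_lift p hp i inferInstance sq l h₁ h₂
    · rintro ⟨l, h₁, h₂⟩
      -- A lift factors the square through an identity, whose replacement is a trivial fibration and
      -- so has contractible fibre.
      let φ : Arrow.mk i ⟶ Arrow.mk (𝟙 p.left) := Arrow.homMk sq.left l (by simp [h₁])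
      let ψ : Arrow.mk (𝟙 p.left) ⟶ p := Arrow.homMk (𝟙 _) p.hom
      have h : sq = φ ≫ ψ := by ext <;> simp [φ, ψ, h₂]
      have : WeakEquivalence (replacementMap (Arrow.mk (𝟙 p.left))) :=
        weakEquivalence_of_precomp_of_fac
          (fg := 𝟙 p.left ≫ toFibrantReplacement p.left)
          (toReplacementSource_replacementMap (Arrow.mk (𝟙 p.left)))
      have : WeakEquivalence
          (terminal.from (fibre (Arrow.mk (replacementMap (Arrow.mk (𝟙 p.left)))))) :=
        weakEquivalence_terminal_from_kernel (replacementMap (Arrow.mk (𝟙 p.left)))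
      rw [h, replacementHom_comp, fibreMap_comp]
      exact toHo_map_eq_zero_of_contractible _ _
  obstruction_comp p p' hp hp' sq φ := by
    have := hS.isIso p hp
    have := hS.isIso p' hp'
    rw [IsIso.comp_inv_eq, Category.assoc, Category.assoc, ← Functor.map_comp (toHo C) (fibreMap φ),
      ← fibreMap_comp, ← toReplacement_naturality, fibreMap_comp, Functor.map_comp,
      IsIso.inv_hom_id_assoc, replacementHom_comp, fibreMap_comp, Functor.map_comp]

/-- In a left proper model category, a cofibration has an obstruction theory if its cofibrant
replacement does. -/
lemma nonempty_relativeObstructionTheory [IsStable C] (hC : IsLeftProper C)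
    {S : MorphismProperty C} (hS : IsReplaceable S) (hS' : S ≤ fibrations C)
    {A B : C} (i : A ⟶ B) [Cofibration i] : Nonempty (RelativeObstructionTheory S i) := by
  obtain ⟨j, k, t, hjt, _, _, _⟩ := exists_cofibration_trivialFibration
    (fromCofibrantReplacement A ≫ i)
  let F := relativeObstructionTheory hS k
  let τ : Arrow.mk k ⟶ Arrow.mk i := Arrow.homMk (fromCofibrantReplacement A) t hjt.symm
  have := hC.weakEquivalence_of_isPushout
    (IsPushout.of_hasPushout k (fromCofibrantReplacement A)) inferInstance inferInstance
  -- Left properness makes `e` a weak equivalence under `A`. A lift for `k` is the same as a lift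
  -- for the cobase change of `k` to `A`, and `e` transfers it to `i`.
  let e : pushout k (fromCofibrantReplacement A) ⟶ B := pushout.desc t i hjt
  have he : pushout.inl _ _ ≫ e = t := pushout.inl_desc _ _ _
  have : WeakEquivalence e := weakEquivalence_of_precomp_of_fac he
  refine ⟨{
    W := F.W
    obstruction p hp sq := F.obstruction p hp (τ ≫ sq)
    obstruction_eq_zero_iff p hp sq := ?_
    obstruction_comp p p' hp hp' sq φ := by
      rw [← Category.assoc, F.obstruction_comp p p' hp hp'] }⟩
  have : Fibration p.hom := ⟨hS' _ hp⟩
  rw [F.obstruction_eq_zero_iff]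
  constructor
  · rintro ⟨l, h₁, h₂⟩
    replace h₁ : k ≫ l = fromCofibrantReplacement A ≫ sq.left := h₁
    replace h₂ : l ≫ p.hom = t ≫ sq.right := h₂
    obtain ⟨l', h₃, h₄⟩ := exists_lift_of_weakEquivalence_under i
      (pushout.inr k (fromCofibrantReplacement A)) e (pushout.inr_desc _ _ _) p.hom sq.right
      (pushout.desc l sq.left h₁) (by
        ext
        · rw [pushout.inl_desc_assoc, h₂, reassoc_of% he]
        · rw [pushout.inr_desc_assoc, pushout.inr_desc_assoc]
          exact sq.w)
    exact ⟨l', by rw [h₃, pushout.inr_desc], h₄⟩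
  · rintro ⟨l, h₁, h₂⟩
    exact ⟨t ≫ l, by simp [τ, reassoc_of% hjt, h₁], by simp [τ, h₂]⟩

end Main

end ObstructionTheory

theorem corollary8p4 {C : Type u} [Category.{v} C] [ModelCategory C]
    [HasZeroObject C] [HasZeroMorphisms C]
    [(cofibrations C).HasFunctorialFactorization (trivialFibrations C)]
    [(trivialCofibrations C).HasFunctorialFactorization (fibrations C)]
    [ObstructionTheory.IsStable C] :
    (∀ {A B : C} (i : A ⟶ B), Cofibration i → IsCofibrant A →
      ObstructionTheory.HasFibrantObstructionTheory i) ∧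
    (ObstructionTheory.IsLeftProper C → ∀ {A B : C} (i : A ⟶ B), Cofibration i →
      ObstructionTheory.HasFibrantObstructionTheory i) ∧
    (ObstructionTheory.IsLeftProper C → ObstructionTheory.IsRightProper C →
      ∀ {A B : C} (i : A ⟶ B), Cofibration i → ObstructionTheory.HasObstructionTheory i) := by
  refine ⟨fun i _ _ ↦ ?_, fun hC _ _ i _ ↦ ?_, fun hC hC' _ _ i _ ↦ ?_⟩
  · exact ⟨ObstructionTheory.relativeObstructionTheory
      ObstructionTheory.isReplaceable_fibrationsWithFibrantTarget i⟩
  · exact ObstructionTheory.nonempty_relativeObstructionTheory hC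
      ObstructionTheory.isReplaceable_fibrationsWithFibrantTarget (fun _ _ _ hp ↦ hp.1.mem) i
  · exact ObstructionTheory.nonempty_relativeObstructionTheory hC
      (ObstructionTheory.isReplaceable_fibrations hC') le_rfl i
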